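/- Let three point particles with masses $m_1,m_2,m_3>0$ move freely between collisions in a real inner product space $E$ of dimension at least $2$ (for instance the plane or three-dimensional space), and put $a=m_1/m_2$, $b=m_3/m_2$. In a hard elastic collision of type $(3)$ (resp. $(2)$) the particles $1$ and $2$ (resp. $1$ and $3$) are at the same place, the velocity of the remaining particle does not change, and total momentum and total kinetic energy are conserved; every scattering angle is permitted, including $0$. For an integer $n\ge 1$, a capture process $(32)^n$ is a motion through $2n$ successive collisions of types $(3),(2),(3),(2),\dots,(3),(2)$, with all time intervals between successive collisions positive, such that initially $2$ and $3$ are at rest at different points and $1$ has non-zero velocity, and finally $1$ and $2$ have equal velocities. Let $C_{2n-1}$ be the curve $$a=\cot\tfrac{\theta}{2}\,\cot n\theta,\quad b=\cot n\theta\,\cot\left(n-\tfrac12\right)\theta,\qquad \tfrac{(2n-2)\pi}{2n-1}<\theta<\tfrac{(2n-1)\pi}{2n},$$ and let $C_{2n}$ be the curve $$a=-\cot\tfrac{\theta}{2}\,\cot n\theta,\quad b=\cot n\theta\,\cot\left(n+\tfrac12\right)\theta,\qquad \tfrac{(2n-1)\pi}{2n}<\theta<\tfrac{2n\pi}{2n+1}.$$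 1. For every $b_0>0$ the line $b=b_0$ meets $C_{2n}$ in exactly one point $(a_L,b_0)$ and $C_{2n-1}$ in exactly one point $(a_R,b_0)$, and $0<a_L<a_R$. Say that $(a,b)$ lies between the curves if $a_L\le a\le a_R$ for $b_0=b$. 2. A capture process $(32)^n$ exists if and only if $(a,b)$ lies between $C_{2n-1}$ and $C_{2n}$. A capture process $(32)^n$ in which every collision changes the velocities exists if and only if $(a,b)$ lies between the curves and not on $C_{2n-1}$. 3. If $(a,b)$ lies between the curves, there is exactly one $\theta>0$ in the interval $\left(\frac{(2n-3)\pi}{2n-1},\pi\right)$ with $\sin n\theta\neq0$ and $$\frac{\cos^2(\theta/2)}{\sin^2(n\theta)}=\frac{a(1+b)}{a+b}.$$ In every capture process $(32)^n$, each collision other than the first has a scattering angle $\beta$ (the angle between the relative velocities of the colliding particles before and after the collision) with $$\cos\theta=1-\frac{2b\sin^2(\beta/2)}{(a+1)(a+b)}.$$ -/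

import Mathlib

open Set

/-!  Collisions of three point particles moving freely in a Euclidean space `E`.

Particle `1`, `2`, `3` has index `0`, `1`, `2` in `Fin 3`. A binary collision is named by its
*spectator*, the particle that does not take part in it. -/

/-- A hard elastic collision with spectator `s` turns the velocities `v` into `v'`: the spectator
keeps its velocity, and total momentum and total kinetic energy are conserved. Every scattering
angle is permitted, the angle zero included. -/
structure IsElasticCollision {E : Type*} [NormedAddCommGroup E] [InnerProductSpace ℝ E]
    (m : Fin 3 → ℝ) (s : Fin 3) (v v' : Fin 3 → E) : Prop where
  spectator : v' s = v s
  momentum : ∑ i, m i • v' i = ∑ i, m i • v i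
  energy : ∑ i, (1 / 2) * m i * ‖v' i‖ ^ 2 = ∑ i, (1 / 2) * m i * ‖v i‖ ^ 2

/-- A motion of three particles with masses `m` through `N` successive collisions, numbered
`0, …, N - 1`, the `k`-th one having spectator `s k`. All time intervals between successive
collisions are positive. Only the values at `k < N` of `time` and `pos`, and at `k ≤ N` of `vel`,
carry meaning. -/
structure CollisionSequence (E : Type*) [NormedAddCommGroup E] [InnerProductSpace ℝ E]
    (m : Fin 3 → ℝ) (N : ℕ) (s : ℕ → Fin 3) where
  /-- the time of the `k`-th collision -/
  time : ℕ → ℝ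
  /-- the positions at the time of the `k`-th collision -/
  pos : ℕ → Fin 3 → E
  /-- `vel k` are the velocities just before, `vel (k + 1)` those just after collision `k` -/
  vel : ℕ → Fin 3 → E
  time_lt : ∀ k, k + 1 < N → time k < time (k + 1)
  free : ∀ k, k + 1 < N → ∀ i,
    pos (k + 1) i = pos k i + (time (k + 1) - time k) • vel (k + 1) i
  contact : ∀ k, k < N → ∀ i j, i ≠ s k → j ≠ s k → pos k i = pos k j
  elastic : ∀ k, k < N → IsElasticCollision m (s k) (vel k) (vel (k + 1))

namespace CollisionSequence

/-- The sequence is a capture process `1 + (2,3) → (1,2) + 3`: initially particles 2 and 3 are at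
rest at two different points and particle 1 is moving; finally 1 and 2 have the same velocity. -/
structure IsCapture {E : Type*} [NormedAddCommGroup E] [InnerProductSpace ℝ E]
    {m : Fin 3 → ℝ} {N : ℕ} {s : ℕ → Fin 3} (P : CollisionSequence E m N s) : Prop where
  rest_two : P.vel 0 1 = 0
  rest_three : P.vel 0 2 = 0
  incident : P.vel 0 0 ≠ 0
  separated : P.pos 0 1 ≠ P.pos 0 2
  captured : P.vel N 0 = P.vel N 1

/-- Every collision of the sequence really changes the velocities. -/
def IsGenuine {E : Type*} [NormedAddCommGroup E] [InnerProductSpace ℝ E]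
    {m : Fin 3 → ℝ} {N : ℕ} {s : ℕ → Fin 3} (P : CollisionSequence E m N s) : Prop :=
  ∀ k, k < N → P.vel (k + 1) ≠ P.vel k

/-- The (unoriented) scattering angle of collision `k`: the angle between the relative velocities
of the colliding pair, `s k + 1` and `s k + 2` modulo 3, before and after the collision. -/
noncomputable def scatteringAngle {E : Type*} [NormedAddCommGroup E] [InnerProductSpace ℝ E]
    {m : Fin 3 → ℝ} {N : ℕ} {s : ℕ → Fin 3} (P : CollisionSequence E m N s) (k : ℕ) : ℝ :=
  InnerProductGeometry.angle (P.vel k (s k + 1) - P.vel k (s k + 2))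
    (P.vel (k + 1) (s k + 1) - P.vel (k + 1) (s k + 2))

end CollisionSequence

/-- The spectators in the process `(32)ⁿ`: particle 3, particle 2, particle 3, particle 2, … -/
def word32 (k : ℕ) : Fin 3 := if Even k then 2 else 1

/-- A capture process of type `(32)ⁿ` for particles with masses `m`: `2 n` collisions. -/
abbrev Process32 (E : Type*) [NormedAddCommGroup E] [InnerProductSpace ℝ E]
    (m : Fin 3 → ℝ) (n : ℕ) : Type _ :=
  {P : CollisionSequence E m (2 * n) word32 // P.IsCapture}

/-- The curve `C_{2n-1}` in the `(a, b)`-plane. -/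
noncomputable def curveOdd (n : ℕ) : Set (ℝ × ℝ) :=
  (fun θ : ℝ => (Real.cot (θ / 2) * Real.cot (n * θ),
      Real.cot (n * θ) * Real.cot ((n - 1 / 2) * θ))) ''
    Ioo ((2 * n - 2) * Real.pi / (2 * n - 1)) ((2 * n - 1) * Real.pi / (2 * n))

/-- The curve `C_{2n}` in the `(a, b)`-plane. -/
noncomputable def curveEven (n : ℕ) : Set (ℝ × ℝ) :=
  (fun θ : ℝ => (-Real.cot (θ / 2) * Real.cot (n * θ),
      Real.cot (n * θ) * Real.cot ((n + 1 / 2) * θ))) ''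
    Ioo ((2 * n - 1) * Real.pi / (2 * n)) (2 * n * Real.pi / (2 * n + 1))

/-- The closed region between the curves: `(a, b)` lies on a horizontal segment that joins a point
of `C_{2n}` (on the left) to a point of `C_{2n-1}` (on the right). -/
def captureRegion (n : ℕ) : Set (ℝ × ℝ) :=
  {p | ∃ aL aR : ℝ, (aL, p.2) ∈ curveEven n ∧ (aR, p.2) ∈ curveOdd n ∧ aL ≤ p.1 ∧ p.1 ≤ aR}

/-- `θ` is a solution of `cos²(θ/2) / sin²(nθ) = a(1+b)/(a+b)` with `0 < θ` in the interval
`((2n-3)π/(2n-1), π)`. -/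
def IsAdmissibleAngle (n : ℕ) (a b θ : ℝ) : Prop :=
  0 < θ ∧ θ ∈ Ioo ((2 * n - 3) * Real.pi / (2 * n - 1)) Real.pi ∧ Real.sin (n * θ) ≠ 0 ∧
    Real.cos (θ / 2) ^ 2 / Real.sin (n * θ) ^ 2 = a * (1 + b) / (a + b)

/-!
Throughout, `N = 2 n`, `ψ = (π - θ) / 2`, and `q k = x₂ - x₃` at the `k`-th collision.

*Reduction to reflections.* At a collision one of the particles 2, 3 touches particle 1, so `q k` is
up to sign the distance vector from particle 1 to the spectator. Between collisions `k` and `k + 1`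
the pair that has just collided separates along `q (k + 1)` and the other pair approaches along
`q k`. Write `e k` for the direction of `q k`. Conservation of the speed of the colliding pair
gives one speed `ρ k` for each collision, and conservation of momentum becomes
`(ρ k + ρ (k + 2)) e (k + 1) = w (k + 1) ρ (k + 1) (e k + e (k + 2))` with a mass ratio `w`
that alternates between `m₂ / (m₁ + m₂)` and `m₃ / (m₁ + m₃)`. The last collision fits the same
pattern with `ρ N = 0`, because particles 1 and 2 end with the same velocity. Such data is an
`IsCollisionChain`; conversely each chain comes from a capture process
(`CollisionSequence.isCollisionChain`, `IsCollisionChain.exists_capture`).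

*Solution of the chain.* The unit vector `e (k + 1)` bisects the angle of `e k` and `e (k + 2)`, so
`c = ⟪e k, e (k + 1)⟫` does not depend on `k`, and the scattering angle `β` satisfies
`sin² (β / 2) = c²` at each collision after the first. The speeds then satisfy a linear recurrence
whose solution vanishing at `N` is `ρ k = C d k sin ((N - k) ψ)`, where `d` depends on the parity of
`k` only and `cos ψ = d 0 d 1 c`. Positivity of the speeds is `N ψ < π`, and the condition that
particles 2 and 3 are initially at rest becomes `sin ψ sin γ = sin δ sin (N ψ)`, that is
the equation for `θ`. Here `δ, γ, ε` are the acute angles `angleOne`, `angleTwo`, `angleThree` with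
sum `π`, determined by `a = tan δ / tan γ` and `b = tan ε / tan γ`; moreover `cos δ = d 0 d 1`,
so that `c ≤ 1` reads `δ ≤ ψ` (`IsCollisionChain.exists_angle`, `exists_chain`).

*The region.* As `sin (N x) / sin x` decreases on `(0, π / N)`, such a `ψ` is unique, and it exists
exactly when `γ ≤ N δ ≤ π - γ` (`exists_angle_iff`). The two boundary cases `γ = N δ` and
`γ = π - N δ` are the curves `C_{2n}` and `C_{2n-1}`. For fixed `b` the angle `δ` increases and
`γ, ε` decrease with `a`, so these inequalities describe a segment of the horizontal line
(`curve_line`). On `C_{2n-1}`, and only there, the first collision is trivial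
(`IsCollisionChain.trivial_iff`).
-/

/-! ### The triangle of angles attached to the mass ratios -/

/-- The angle `δ` with `cos² δ = m₂ m₃ / ((m₁ + m₂) (m₁ + m₃))`, in terms of `a = m₁ / m₂` and
`b = m₃ / m₂`: in the mass metric it is the acute angle between the lines on which particle 1 meets
particle 2, respectively particle 3. -/
noncomputable def angleOne (a b : ℝ) : ℝ := Real.arccos (√b / (√(a + b) * √(a + 1)))
/-- The analogue of `angleOne` for particle 2: `cos² γ = m₁ m₃ / ((m₁ + m₂) (m₂ + m₃))`. -/
noncomputable def angleTwo (a b : ℝ) : ℝ := Real.arccos (√a * √b / (√(a + 1) * √(b + 1)))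
/-- The analogue of `angleOne` for particle 3: `cos² ε = m₁ m₂ / ((m₁ + m₃) (m₂ + m₃))`. -/
noncomputable def angleThree (a b : ℝ) : ℝ := Real.arccos (√a / (√(a + b) * √(b + 1)))

lemma cos_sin_arccos {x y : ℝ} (hx : 0 < x) (hy : 0 < y) (h : x ^ 2 + y ^ 2 = 1) :
    Real.cos (Real.arccos x) = x ∧ Real.sin (Real.arccos x) = y ∧
      0 < Real.arccos x ∧ Real.arccos x < Real.pi / 2 := by
  have hx1 : x < 1 := by nlinarith
  refine ⟨Real.cos_arccos (by linarith) hx1.le, ?_, Real.arccos_pos.2 hx1,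
    Real.arccos_lt_pi_div_two.2 hx⟩
  rw [Real.sin_arccos, show 1 - x ^ 2 = y ^ 2 by linarith, Real.sqrt_sq hy.le]

lemma angleOne_spec {a b : ℝ} (ha : 0 < a) (hb : 0 < b) :
    Real.cos (angleOne a b) = √b / (√(a + b) * √(a + 1)) ∧
      Real.sin (angleOne a b) = √a * √(a + b + 1) / (√(a + b) * √(a + 1)) ∧
      0 < angleOne a b ∧ angleOne a b < Real.pi / 2 := by
  refine cos_sin_arccos (by positivity) (by positivity) ?_
  rw [div_pow, div_pow, mul_pow, mul_pow, Real.sq_sqrt (by positivity), Real.sq_sqrt (by positivity),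
    Real.sq_sqrt (by positivity), Real.sq_sqrt (by positivity), Real.sq_sqrt (by positivity)]
  field_simp
  ring

lemma angleTwo_spec {a b : ℝ} (ha : 0 < a) (hb : 0 < b) :
    Real.cos (angleTwo a b) = √a * √b / (√(a + 1) * √(b + 1)) ∧
      Real.sin (angleTwo a b) = √(a + b + 1) / (√(a + 1) * √(b + 1)) ∧
      0 < angleTwo a b ∧ angleTwo a b < Real.pi / 2 := by
  refine cos_sin_arccos (by positivity) (by positivity) ?_
  rw [div_pow, div_pow, mul_pow, mul_pow, Real.sq_sqrt (by positivity), Real.sq_sqrt (by positivity),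
    Real.sq_sqrt (by positivity), Real.sq_sqrt (by positivity), Real.sq_sqrt (by positivity)]
  field_simp
  ring

lemma angleThree_spec {a b : ℝ} (ha : 0 < a) (hb : 0 < b) :
    Real.cos (angleThree a b) = √a / (√(a + b) * √(b + 1)) ∧
      Real.sin (angleThree a b) = √b * √(a + b + 1) / (√(a + b) * √(b + 1)) ∧
      0 < angleThree a b ∧ angleThree a b < Real.pi / 2 := by
  refine cos_sin_arccos (by positivity) (by positivity) ?_
  rw [div_pow, div_pow, mul_pow, mul_pow, Real.sq_sqrt (by positivity), Real.sq_sqrt (by positivity),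
    Real.sq_sqrt (by positivity), Real.sq_sqrt (by positivity), Real.sq_sqrt (by positivity)]
  field_simp
  ring

lemma angle_sum {a b : ℝ} (ha : 0 < a) (hb : 0 < b) :
    angleOne a b + angleTwo a b + angleThree a b = Real.pi := by
  obtain ⟨c1, s1, p1, q1⟩ := angleOne_spec ha hb
  obtain ⟨c2, s2, p2, q2⟩ := angleTwo_spec ha hb
  obtain ⟨c3, s3, p3, q3⟩ := angleThree_spec ha hb
  have key : Real.cos (angleOne a b + angleTwo a b) = Real.cos (Real.pi - angleThree a b) := by
    rw [Real.cos_pi_sub, Real.cos_add, c1, c2, c3, s1, s2]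
    field_simp
    rw [Real.sq_sqrt (by positivity), Real.sq_sqrt (by positivity), Real.sq_sqrt (by positivity)]
    ring
  have := Real.injOn_cos ⟨by linarith, by linarith⟩ ⟨by linarith, by linarith⟩ key
  linarith

lemma tan_angleOne_div {a b : ℝ} (ha : 0 < a) (hb : 0 < b) :
    Real.tan (angleOne a b) / Real.tan (angleTwo a b) = a := by
  obtain ⟨c1, s1, -⟩ := angleOne_spec ha hb
  obtain ⟨c2, s2, -⟩ := angleTwo_spec ha hb
  rw [Real.tan_eq_sin_div_cos, Real.tan_eq_sin_div_cos, c1, c2, s1, s2]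
  field_simp
  exact Real.sq_sqrt ha.le

lemma tan_angleThree_div {a b : ℝ} (ha : 0 < a) (hb : 0 < b) :
    Real.tan (angleThree a b) / Real.tan (angleTwo a b) = b := by
  obtain ⟨c1, s1, -⟩ := angleThree_spec ha hb
  obtain ⟨c2, s2, -⟩ := angleTwo_spec ha hb
  rw [Real.tan_eq_sin_div_cos, Real.tan_eq_sin_div_cos, c1, c2, s1, s2]
  field_simp
  exact Real.sq_sqrt hb.le

/-- Every acute triangle is the one attached to the mass ratios `tan δ / tan γ` and `tan ε / tan γ`. -/
lemma angles_of_tan {δ γ ε : ℝ} (hδ : 0 < δ) (hδ' : δ < Real.pi / 2) (hγ : 0 < γ)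
    (hγ' : γ < Real.pi / 2) (hε : 0 < ε) (hε' : ε < Real.pi / 2) (h : δ + γ + ε = Real.pi) :
    0 < Real.tan δ / Real.tan γ ∧ 0 < Real.tan ε / Real.tan γ ∧
      angleOne (Real.tan δ / Real.tan γ) (Real.tan ε / Real.tan γ) = δ ∧
      angleTwo (Real.tan δ / Real.tan γ) (Real.tan ε / Real.tan γ) = γ := by
  have t1 := Real.tan_pos_of_pos_of_lt_pi_div_two hδ hδ'
  have t2 := Real.tan_pos_of_pos_of_lt_pi_div_two hγ hγ'
  have t3 := Real.tan_pos_of_pos_of_lt_pi_div_two hε hε'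
  have ha : 0 < Real.tan δ / Real.tan γ := div_pos t1 t2
  have hb : 0 < Real.tan ε / Real.tan γ := div_pos t3 t2
  have s1 := Real.sin_pos_of_pos_of_lt_pi hδ (by linarith)
  have s2 := Real.sin_pos_of_pos_of_lt_pi hγ (by linarith)
  have s3 := Real.sin_pos_of_pos_of_lt_pi hε (by linarith)
  have c1 := Real.cos_pos_of_mem_Ioo (x := δ) ⟨by linarith, by linarith⟩
  have c2 := Real.cos_pos_of_mem_Ioo (x := γ) ⟨by linarith, by linarith⟩
  have c3 := Real.cos_pos_of_mem_Ioo (x := ε) ⟨by linarith, by linarith⟩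
  have e3 : Real.sin δ * Real.cos γ + Real.cos δ * Real.sin γ = Real.sin ε := by
    rw [← Real.sin_add, ← Real.sin_pi_sub]; congr 1; linarith
  have e2 : Real.sin δ * Real.cos ε + Real.cos δ * Real.sin ε = Real.sin γ := by
    rw [← Real.sin_add, ← Real.sin_pi_sub]; congr 1; linarith
  have e1 : Real.sin ε * Real.cos γ + Real.cos ε * Real.sin γ = Real.sin δ := by
    rw [← Real.sin_add, ← Real.sin_pi_sub]; congr 1; linarith
  have a1 : Real.tan δ / Real.tan γ + 1 = Real.sin ε / (Real.cos δ * Real.sin γ) := by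
    rw [← e3, Real.tan_eq_sin_div_cos, Real.tan_eq_sin_div_cos]; field_simp
  have b1 : Real.tan ε / Real.tan γ + 1 = Real.sin δ / (Real.cos ε * Real.sin γ) := by
    rw [← e1, Real.tan_eq_sin_div_cos, Real.tan_eq_sin_div_cos]; field_simp
  have ab : Real.tan δ / Real.tan γ + Real.tan ε / Real.tan γ
      = Real.cos γ / (Real.cos δ * Real.cos ε) := by
    rw [Real.tan_eq_sin_div_cos, Real.tan_eq_sin_div_cos, Real.tan_eq_sin_div_cos]
    field_simp
    linarith
  refine ⟨ha, hb, ?_, ?_⟩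
  · obtain ⟨c, -, p, q⟩ := angleOne_spec ha hb
    refine Real.injOn_cos ⟨p.le, by linarith⟩ ⟨hδ.le, by linarith⟩ ?_
    refine (pow_left_inj₀ (by rw [c]; positivity) c1.le two_ne_zero).1 ?_
    rw [c, div_pow, mul_pow, Real.sq_sqrt (by positivity), Real.sq_sqrt (by positivity),
      Real.sq_sqrt (by positivity), a1, ab, Real.tan_eq_sin_div_cos, Real.tan_eq_sin_div_cos]
    field_simp
  · obtain ⟨c, -, p, q⟩ := angleTwo_spec ha hb
    refine Real.injOn_cos ⟨p.le, by linarith⟩ ⟨hγ.le, by linarith⟩ ?_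
    refine (pow_left_inj₀ (by rw [c]; positivity) c2.le two_ne_zero).1 ?_
    rw [c, div_pow, mul_pow, mul_pow, Real.sq_sqrt (by positivity), Real.sq_sqrt (by positivity),
      Real.sq_sqrt (by positivity), Real.sq_sqrt (by positivity), a1, b1, Real.tan_eq_sin_div_cos,
      Real.tan_eq_sin_div_cos, Real.tan_eq_sin_div_cos]
    field_simp

/-! ### Dependence of the angles on `a` -/

lemma sqrt_div_sqrt_add_lt {a a' c : ℝ} (ha : 0 < a) (h : a < a') (hc : 0 < c) :
    √a / √(a + c) < √a' / √(a' + c) := by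
  have ha' := ha.trans h
  rw [← Real.sqrt_div ha.le, ← Real.sqrt_div ha'.le]
  refine Real.sqrt_lt_sqrt (by positivity) ?_
  rw [div_lt_div_iff₀ (by positivity) (by positivity)]
  nlinarith

lemma angleOne_lt {a a' b : ℝ} (ha : 0 < a) (h : a < a') (hb : 0 < b) :
    angleOne a b < angleOne a' b := by
  refine Real.arccos_lt_arccos ?_ ?_ (Real.arccos_pos.1 (angleOne_spec ha hb).2.2.1).le
  · have : (0 : ℝ) ≤ √b / (√(a' + b) * √(a' + 1)) := by positivity
    linarith
  · have : 0 < a' := ha.trans h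
    gcongr

lemma angleTwo_lt {a a' b : ℝ} (ha : 0 < a) (h : a < a') (hb : 0 < b) :
    angleTwo a' b < angleTwo a b := by
  refine Real.arccos_lt_arccos ?_ ?_
    (Real.arccos_pos.1 (angleTwo_spec (ha.trans h) hb).2.2.1).le
  · have : (0 : ℝ) ≤ √a * √b / (√(a + 1) * √(b + 1)) := by positivity
    linarith
  · have := sqrt_div_sqrt_add_lt ha h one_pos
    rw [mul_div_mul_comm, mul_div_mul_comm]
    gcongr

lemma angleThree_lt {a a' b : ℝ} (ha : 0 < a) (h : a < a') (hb : 0 < b) :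
    angleThree a' b < angleThree a b := by
  refine Real.arccos_lt_arccos ?_ ?_
    (Real.arccos_pos.1 (angleThree_spec (ha.trans h) hb).2.2.1).le
  · have : (0 : ℝ) ≤ √a / (√(a + b) * √(b + 1)) := by positivity
    linarith
  · have := sqrt_div_sqrt_add_lt ha h hb
    rw [← div_div, ← div_div]
    gcongr

/-- The function `N δ - γ` of `a` is negative at `a = 0`, and nonnegative at `a = 1`, where `γ = δ`. -/
lemma exists_angleTwo_eq {N b : ℝ} (hN : 1 ≤ N) (hb : 0 < b) :
    ∃ a, 0 < a ∧ angleTwo a b = N * angleOne a b := by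
  have hc : ContinuousOn (fun a => N * angleOne a b - angleTwo a b) (Icc 0 1) := by
    unfold angleOne angleTwo
    refine ContinuousOn.sub (continuousOn_const.mul (Real.continuous_arccos.comp_continuousOn
      (ContinuousOn.div (by fun_prop) (by fun_prop) ?_)))
      (Real.continuous_arccos.comp_continuousOn
      (ContinuousOn.div (by fun_prop) (by fun_prop) ?_)) <;>
    · intro x hx
      have := hx.1
      positivity
  have h0 : N * angleOne 0 b - angleTwo 0 b < 0 := by
    have : √b ≠ 0 := by positivity
    simp [angleOne, angleTwo, this, Real.pi_pos]
  have h1 : 0 ≤ N * angleOne 1 b - angleTwo 1 b := by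
    have : angleTwo 1 b = angleOne 1 b := by
      simp only [angleOne, angleTwo, Real.sqrt_one, one_mul, add_comm b 1]
      rw [mul_comm (√(1 + b))]
    rw [this]
    nlinarith [(angleOne_spec one_pos hb).2.2.1]
  obtain ⟨x, hx, hx0⟩ := intermediate_value_Icc zero_le_one hc ⟨h0.le, h1⟩
  refine ⟨x, hx.1.lt_of_ne ?_, by simp only at hx0; linarith⟩
  rintro rfl
  exact h0.ne hx0

/-- The function `M δ - ε` of `a` is negative at `a = 0`, and nonnegative at `a = b`, where `ε = δ`. -/
lemma exists_angleThree_eq {M b : ℝ} (hM : 1 ≤ M) (hb : 0 < b) :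
    ∃ a, 0 < a ∧ angleThree a b = M * angleOne a b := by
  have hc : ContinuousOn (fun a => M * angleOne a b - angleThree a b) (Icc 0 b) := by
    unfold angleOne angleThree
    refine ContinuousOn.sub (continuousOn_const.mul (Real.continuous_arccos.comp_continuousOn
      (ContinuousOn.div (by fun_prop) (by fun_prop) ?_)))
      (Real.continuous_arccos.comp_continuousOn
      (ContinuousOn.div (by fun_prop) (by fun_prop) ?_)) <;>
    · intro x hx
      have := hx.1
      positivity
  have h0 : M * angleOne 0 b - angleThree 0 b < 0 := by
    have : √b ≠ 0 := by positivity
    simp [angleOne, angleThree, this, Real.pi_pos]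
  have h1 : 0 ≤ M * angleOne b b - angleThree b b := by
    change 0 ≤ M * angleOne b b - angleOne b b
    nlinarith [(angleOne_spec hb hb).2.2.1]
  obtain ⟨x, hx, hx0⟩ := intermediate_value_Icc hb.le hc ⟨h0.le, h1⟩
  refine ⟨x, hx.1.lt_of_ne ?_, by simp only at hx0; linarith⟩
  rintro rfl
  exact h0.ne hx0

/-! ### The curves in terms of the angles -/

lemma cot_eq_inv_tan (x : ℝ) : Real.cot x = (Real.tan x)⁻¹ := by
  rw [Real.cot_eq_cos_div_sin, Real.tan_eq_sin_div_cos, inv_div]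

lemma cot_nat_mul_pi_sub (n : ℕ) (x : ℝ) : Real.cot (n * Real.pi - x) = -(Real.tan x)⁻¹ := by
  rw [cot_eq_inv_tan, Real.tan_nat_mul_pi_sub, inv_neg]

lemma cot_pi_div_two_sub (x : ℝ) : Real.cot (Real.pi / 2 - x) = Real.tan x := by
  rw [cot_eq_inv_tan, Real.tan_pi_div_two_sub, inv_inv]

/-- The point of `C_{2n-1}` with parameter `θ = π - 2 ψ` belongs to the triangle with angles `ψ`,
`π - 2 n ψ` and `(2 n - 1) ψ`. -/
lemma odd_point (n : ℕ) (ψ : ℝ) :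
    (Real.cot ((Real.pi - 2 * ψ) / 2) * Real.cot (n * (Real.pi - 2 * ψ)),
      Real.cot (n * (Real.pi - 2 * ψ)) * Real.cot ((n - 1 / 2) * (Real.pi - 2 * ψ))) =
    (Real.tan ψ / Real.tan (Real.pi - 2 * n * ψ),
      Real.tan ((2 * n - 1) * ψ) / Real.tan (Real.pi - 2 * n * ψ)) := by
  have h1 : (Real.pi - 2 * ψ) / 2 = Real.pi / 2 - ψ := by ring
  have h2 : n * (Real.pi - 2 * ψ) = n * Real.pi - 2 * n * ψ := by ring
  have h3 : ((n : ℝ) - 1 / 2) * (Real.pi - 2 * ψ) =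
    n * Real.pi - (Real.pi / 2 - (-((2 * n - 1) * ψ))) := by ring
  rw [h1, h2, h3, cot_pi_div_two_sub, cot_nat_mul_pi_sub, cot_nat_mul_pi_sub,
    Real.tan_pi_div_two_sub, Real.tan_pi_sub, Real.tan_neg]
  simp only [Prod.mk.injEq, inv_neg, inv_inv]
  constructor <;> ring

/-- The point of `C_{2n}` with parameter `θ = π - 2 ψ` belongs to the triangle with angles `ψ`,
`2 n ψ` and `π - (2 n + 1) ψ`. -/
lemma even_point (n : ℕ) (ψ : ℝ) :
    (-Real.cot ((Real.pi - 2 * ψ) / 2) * Real.cot (n * (Real.pi - 2 * ψ)),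
      Real.cot (n * (Real.pi - 2 * ψ)) * Real.cot ((n + 1 / 2) * (Real.pi - 2 * ψ))) =
    (Real.tan ψ / Real.tan (2 * n * ψ),
      Real.tan (Real.pi - (2 * n + 1) * ψ) / Real.tan (2 * n * ψ)) := by
  have h1 : (Real.pi - 2 * ψ) / 2 = Real.pi / 2 - ψ := by ring
  have h2 : n * (Real.pi - 2 * ψ) = n * Real.pi - 2 * n * ψ := by ring
  have h3 : ((n : ℝ) + 1 / 2) * (Real.pi - 2 * ψ) =
    n * Real.pi - (((2 * n + 1) * ψ) - Real.pi / 2) := by ring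
  rw [h1, h2, h3, cot_pi_div_two_sub, cot_nat_mul_pi_sub, cot_nat_mul_pi_sub, ← neg_sub,
    Real.tan_neg, Real.tan_pi_div_two_sub, Real.tan_pi_sub]
  simp only [Prod.mk.injEq, inv_neg, inv_inv]
  constructor <;> ring

lemma mem_curveOdd_iff {n : ℕ} (hn : 1 ≤ n) {a b : ℝ} :
    (a, b) ∈ curveOdd n ↔
      0 < a ∧ 0 < b ∧ angleTwo a b + 2 * n * angleOne a b = Real.pi := by
  have hn' : (1 : ℝ) ≤ n := by exact_mod_cast hn
  have hpi := Real.pi_pos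
  constructor
  · rintro ⟨θ, ⟨h1, h2⟩, h⟩
    rw [div_lt_iff₀ (by linarith)] at h1
    rw [lt_div_iff₀ (by linarith)] at h2
    obtain ⟨ψ, rfl⟩ : ∃ ψ, θ = Real.pi - 2 * ψ := ⟨(Real.pi - θ) / 2, by ring⟩
    simp only [odd_point, Prod.mk.injEq] at h
    have hψ : 0 < ψ := by nlinarith
    obtain ⟨k1, k2, k3, k4⟩ := angles_of_tan (δ := ψ) (γ := Real.pi - 2 * n * ψ)
      (ε := (2 * n - 1) * ψ) hψ (by nlinarith) (by nlinarith) (by nlinarith) (by nlinarith)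
      (by nlinarith) (by ring)
    rw [h.1, h.2] at k3 k4
    rw [h.1] at k1
    rw [h.2] at k2
    exact ⟨k1, k2, by rw [k3, k4]; ring⟩
  · rintro ⟨ha, hb, h⟩
    obtain ⟨-, -, p1, q1⟩ := angleOne_spec ha hb
    obtain ⟨-, -, p2, q2⟩ := angleTwo_spec ha hb
    obtain ⟨-, -, p3, q3⟩ := angleThree_spec ha hb
    have hs := angle_sum ha hb
    refine ⟨Real.pi - 2 * angleOne a b, ⟨?_, ?_⟩, ?_⟩
    · rw [div_lt_iff₀ (by linarith)]
      nlinarith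
    · rw [lt_div_iff₀ (by linarith)]
      nlinarith
    · simp only [odd_point]
      rw [show Real.pi - 2 * n * angleOne a b = angleTwo a b by linarith,
        show (2 * n - 1) * angleOne a b = angleThree a b by linarith,
        tan_angleOne_div ha hb, tan_angleThree_div ha hb]

lemma mem_curveEven_iff {n : ℕ} (hn : 1 ≤ n) {a b : ℝ} :
    (a, b) ∈ curveEven n ↔
      0 < a ∧ 0 < b ∧ angleTwo a b = 2 * n * angleOne a b := by
  have hn' : (1 : ℝ) ≤ n := by exact_mod_cast hn
  have hpi := Real.pi_pos
  constructor
  · rintro ⟨θ, ⟨h1, h2⟩, h⟩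
    rw [div_lt_iff₀ (by linarith)] at h1
    rw [lt_div_iff₀ (by linarith)] at h2
    obtain ⟨ψ, rfl⟩ : ∃ ψ, θ = Real.pi - 2 * ψ := ⟨(Real.pi - θ) / 2, by ring⟩
    simp only [even_point, Prod.mk.injEq] at h
    have hψ : 0 < ψ := by nlinarith
    obtain ⟨k1, k2, k3, k4⟩ := angles_of_tan (δ := ψ) (γ := 2 * n * ψ)
      (ε := Real.pi - (2 * n + 1) * ψ) hψ (by nlinarith) (by nlinarith) (by nlinarith)
      (by nlinarith) (by nlinarith) (by ring)
    rw [h.1, h.2] at k3 k4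
    rw [h.1] at k1
    rw [h.2] at k2
    exact ⟨k1, k2, by rw [k3, k4]⟩
  · rintro ⟨ha, hb, h⟩
    obtain ⟨-, -, p1, q1⟩ := angleOne_spec ha hb
    obtain ⟨-, -, p2, q2⟩ := angleTwo_spec ha hb
    obtain ⟨-, -, p3, q3⟩ := angleThree_spec ha hb
    have hs := angle_sum ha hb
    refine ⟨Real.pi - 2 * angleOne a b, ⟨?_, ?_⟩, ?_⟩
    · rw [div_lt_iff₀ (by linarith)]
      nlinarith
    · rw [lt_div_iff₀ (by linarith)]
      nlinarith
    · simp only [even_point]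
      rw [← h, show Real.pi - (2 * n + 1) * angleOne a b = angleThree a b by linarith,
        tan_angleOne_div ha hb, tan_angleThree_div ha hb]

/-- On a horizontal line each curve has one point, and the two inequalities that describe the
region cut out the half-lines to the right of `C_{2n}` and to the left of `C_{2n-1}`. -/
lemma curve_line {n : ℕ} (hn : 1 ≤ n) {b : ℝ} (hb : 0 < b) :
    ∃ aL aR : ℝ, 0 < aL ∧ aL < aR ∧ (∀ a, (a, b) ∈ curveEven n ↔ a = aL) ∧
      (∀ a, (a, b) ∈ curveOdd n ↔ a = aR) ∧
      (∀ a, 0 < a → (aL ≤ a ↔ angleTwo a b ≤ 2 * n * angleOne a b)) ∧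
      (∀ a, 0 < a → (a ≤ aR ↔ angleTwo a b + 2 * n * angleOne a b ≤ Real.pi)) := by
  have hn' : (1 : ℝ) ≤ n := by exact_mod_cast hn
  obtain ⟨aL, hL, eL⟩ := exists_angleTwo_eq (N := 2 * n) (by linarith) hb
  obtain ⟨aR, hR, eR⟩ := exists_angleThree_eq (M := 2 * n - 1) (by linarith) hb
  have monoL : ∀ a a', 0 < a → a < a' →
      2 * n * angleOne a b - angleTwo a b < 2 * n * angleOne a' b - angleTwo a' b := by
    intro a a' ha h
    have h1 := angleOne_lt ha h hb
    have h2 := angleTwo_lt ha h hb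
    nlinarith
  -- `γ + 2 n δ = π + (2 n - 1) δ - ε`, where `δ` increases and `ε` decreases with `a`
  have monoR : ∀ a a', 0 < a → a < a' →
      angleTwo a b + 2 * n * angleOne a b < angleTwo a' b + 2 * n * angleOne a' b := by
    intro a a' ha h
    have h1 := angleOne_lt ha h hb
    have h2 := angleThree_lt ha h hb
    have h3 := angle_sum ha hb
    have h4 := angle_sum (ha.trans h) hb
    nlinarith
  have eR' : angleTwo aR b + 2 * n * angleOne aR b = Real.pi := by
    have := angle_sum hR hb
    linarith
  have iL : ∀ a, 0 < a → (aL ≤ a ↔ angleTwo a b ≤ 2 * n * angleOne a b) := by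
    intro a ha
    rcases lt_trichotomy a aL with h | h | h
    · have := monoL _ _ ha h
      constructor <;> intro <;> linarith
    · subst h; simp [eL]
    · have := monoL _ _ hL h
      constructor <;> intro <;> linarith
  have iR : ∀ a, 0 < a → (a ≤ aR ↔ angleTwo a b + 2 * n * angleOne a b ≤ Real.pi) := by
    intro a ha
    rcases lt_trichotomy a aR with h | h | h
    · have := monoR _ _ ha h
      constructor <;> intro <;> linarith
    · subst h; simp [eR']
    · have := monoR _ _ hR h
      constructor <;> intro <;> linarith
  refine ⟨aL, aR, hL, ?_, fun a => ?_, fun a => ?_, iL, iR⟩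
  · by_contra! h
    have h1 := (iL aL hL).1 le_rfl
    have h2 : Real.pi ≤ angleTwo aL b + 2 * n * angleOne aL b := by
      rcases h.eq_or_lt with rfl | h
      · exact eR'.ge
      · exact eR' ▸ (monoR _ _ hR h).le
    linarith [(angleTwo_spec hL hb).2.2.2]
  · rw [mem_curveEven_iff hn]
    refine ⟨fun ⟨ha, _, h⟩ => ?_, fun h => h ▸ ⟨hL, hb, eL⟩⟩
    rcases lt_trichotomy a aL with h' | h' | h'
    · linarith [monoL _ _ ha h']
    · exact h'
    · linarith [monoL _ _ hL h']
  · rw [mem_curveOdd_iff hn]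
    refine ⟨fun ⟨ha, _, h⟩ => ?_, fun h => h ▸ ⟨hR, hb, eR'⟩⟩
    rcases lt_trichotomy a aR with h' | h' | h'
    · linarith [monoR _ _ ha h']
    · exact h'
    · linarith [monoR _ _ hR h']

lemma mem_captureRegion_iff {n : ℕ} (hn : 1 ≤ n) {a b : ℝ} (ha : 0 < a) (hb : 0 < b) :
    (a, b) ∈ captureRegion n ↔ angleTwo a b ≤ 2 * n * angleOne a b ∧
      angleTwo a b + 2 * n * angleOne a b ≤ Real.pi := by
  obtain ⟨aL, aR, -, -, h1, h2, h3, h4⟩ := curve_line hn hb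
  rw [← h3 a ha, ← h4 a ha]
  simp only [captureRegion, mem_ofPred_eq, h1, h2]
  exact ⟨fun ⟨x, y, hx, hy, h⟩ => hx ▸ hy ▸ h, fun h => ⟨aL, aR, rfl, rfl, h⟩⟩

/-! ### The equation for the angle -/

/-- The quotient `sin (N x) / sin x` is antitone on `(0, π / N]`. -/
lemma sin_mul_sin_nat_mul_le {x y : ℝ} (hx : 0 < x) (hxy : x ≤ y) {N : ℕ} (hN : 1 ≤ N)
    (h : N * y ≤ Real.pi) :
    Real.sin x * Real.sin (N * y) ≤ Real.sin y * Real.sin (N * x) := by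
  induction N, hN using Nat.le_induction with
  | base => simp [mul_comm]
  | succ N hN ih =>
    have hN' : (1 : ℝ) ≤ N := by exact_mod_cast hN
    push_cast at h ⊢
    have hy : 0 < y := hx.trans_le hxy
    have hNy : N * y ≤ Real.pi := by linarith
    have := ih hNy
    have hy2 : y ≤ Real.pi / 2 := by nlinarith
    have hcx : 0 ≤ Real.cos x := Real.cos_nonneg_of_mem_Icc ⟨by linarith, by linarith⟩
    have hc : Real.cos y ≤ Real.cos x := Real.cos_le_cos_of_nonneg_of_le_pi hx.le (by linarith) hxy
    have hcN : Real.cos (N * y) ≤ Real.cos (N * x) :=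
      Real.cos_le_cos_of_nonneg_of_le_pi (by positivity) (by linarith) (by gcongr)
    have sx := Real.sin_nonneg_of_nonneg_of_le_pi hx.le (by linarith)
    have sy := Real.sin_nonneg_of_nonneg_of_le_pi hy.le (by linarith)
    have sNy := Real.sin_nonneg_of_nonneg_of_le_pi (x := N * y) (by positivity) (by linarith)
    rw [add_mul, add_mul, one_mul, one_mul, Real.sin_add, Real.sin_add]
    have e1 := mul_nonneg (mul_nonneg sx sNy) (sub_nonneg.2 hc)
    have e2 := mul_nonneg hcx (sub_nonneg.2 this)
    have e3 := mul_nonneg (mul_nonneg sx sy) (sub_nonneg.2 hcN)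
    linear_combination e1 + e2 + e3

/-- The quotient `sin (N x) / sin x` is strictly antitone on `(0, π / N]` for `N ≥ 2`. -/
lemma sin_mul_sin_nat_mul_lt {x y : ℝ} (hx : 0 < x) (hxy : x < y) {N : ℕ} (hN : 2 ≤ N)
    (h : N * y ≤ Real.pi) :
    Real.sin x * Real.sin (N * y) < Real.sin y * Real.sin (N * x) := by
  obtain ⟨N, rfl⟩ : ∃ M, N = M + 1 := ⟨N - 1, by omega⟩
  have hN' : (1 : ℝ) ≤ N := by exact_mod_cast (by omega : 1 ≤ N)
  push_cast at h ⊢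
  have hy : 0 < y := hx.trans hxy
  have hNy : N * y ≤ Real.pi := by linarith
  have := sin_mul_sin_nat_mul_le hx hxy.le (by omega : 1 ≤ N) hNy
  have hy2 : y ≤ Real.pi / 2 := by nlinarith
  have hcx : 0 ≤ Real.cos x := Real.cos_nonneg_of_mem_Icc ⟨by linarith, by linarith⟩
  have hc : Real.cos y ≤ Real.cos x :=
    Real.cos_le_cos_of_nonneg_of_le_pi hx.le (by linarith) hxy.le
  have hcN : Real.cos (N * y) < Real.cos (N * x) :=
    Real.cos_lt_cos_of_nonneg_of_le_pi (by positivity) (by linarith) (by gcongr)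
  have sx := Real.sin_pos_of_pos_of_lt_pi hx (by linarith)
  have sy := Real.sin_pos_of_pos_of_lt_pi hy (by linarith)
  have sNy := Real.sin_nonneg_of_nonneg_of_le_pi (x := N * y) (by positivity) (by linarith)
  rw [add_mul, add_mul, one_mul, one_mul, Real.sin_add, Real.sin_add]
  have e1 := mul_nonneg (mul_nonneg sx.le sNy) (sub_nonneg.2 hc)
  have e2 := mul_nonneg hcx (sub_nonneg.2 this)
  have e3 := mul_pos (mul_pos sx sy) (sub_pos.2 hcN)
  linear_combination e1 + e2 + e3

lemma eq_of_sin_mul_eq {x y s t : ℝ} {N : ℕ} (hN : 2 ≤ N) (hx : 0 < x) (hy : 0 < y)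
    (hxN : N * x < Real.pi) (hyN : N * y < Real.pi) (hs : s ≠ 0)
    (h1 : Real.sin x * t = s * Real.sin (N * x)) (h2 : Real.sin y * t = s * Real.sin (N * y)) :
    x = y := by
  have key : Real.sin x * Real.sin (N * y) = Real.sin y * Real.sin (N * x) :=
    mul_left_cancel₀ hs (by linear_combination Real.sin y * h1 - Real.sin x * h2)
  rcases lt_trichotomy x y with h | h | h
  · exact absurd key (sin_mul_sin_nat_mul_lt hx h hN hyN.le).ne
  · exact h
  · exact absurd key.symm (sin_mul_sin_nat_mul_lt hy h hN hxN.le).ne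

/-- Under the equation, `δ ≤ ψ` is the same as `sin γ ≤ sin (N ψ)`, that is
`γ ≤ N ψ ≤ π - γ`. A solution with this property exists by the intermediate value theorem on
`[γ / N, (π - γ) / N]` as soon as `δ` lies in that interval, and by monotonicity only then. -/
lemma exists_angle_iff {δ γ : ℝ} {N : ℕ} (hN : 2 ≤ N) (hδ : 0 < δ) (hδ' : δ < Real.pi / 2)
    (hγ : 0 < γ) (hγ' : γ < Real.pi / 2) :
    (∃ ψ, 0 < ψ ∧ N * ψ < Real.pi ∧ δ ≤ ψ ∧
      Real.sin ψ * Real.sin γ = Real.sin δ * Real.sin (N * ψ)) ↔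
      γ ≤ N * δ ∧ γ + N * δ ≤ Real.pi := by
  have hN' : (2 : ℝ) ≤ N := by exact_mod_cast hN
  have hN0 : (0 : ℝ) < N := by linarith
  have sδ := Real.sin_pos_of_pos_of_lt_pi hδ (by linarith)
  have sγ := Real.sin_pos_of_pos_of_lt_pi hγ (by linarith)
  constructor
  · rintro ⟨ψ, h0, hψ, hδψ, h⟩
    have hψ2 : ψ < Real.pi / 2 := by nlinarith
    have sψ := Real.sin_pos_of_pos_of_lt_pi h0 (by linarith)
    have h1 : Real.sin δ ≤ Real.sin ψ :=
      Real.sin_le_sin_of_le_of_le_pi_div_two (by linarith) (by linarith) hδψ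
    have sN := Real.sin_pos_of_pos_of_lt_pi (x := N * ψ) (by positivity) hψ
    have h2 : Real.sin γ ≤ Real.sin (N * ψ) := by
      by_contra! hlt
      nlinarith
    have h3 : γ ≤ N * ψ := by
      by_contra! hlt
      exact absurd h2 (not_le.2 (Real.sin_lt_sin_of_lt_of_le_pi_div_two
        (by linarith [mul_pos hN0 h0]) hγ'.le hlt))
    have h4 : N * ψ ≤ Real.pi - γ := by
      by_contra! hlt
      refine absurd h2 (not_le.2 ?_)
      rw [← Real.sin_pi_sub]
      exact Real.sin_lt_sin_of_lt_of_le_pi_div_two (by linarith) hγ'.le (by linarith)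
    constructor
    · by_contra! hlt
      have hx : δ < γ / N := by rw [lt_div_iff₀ hN0]; linarith
      have hx' : γ / N ≤ ψ := by rw [div_le_iff₀ hN0]; linarith
      have := sin_mul_sin_nat_mul_le (hδ.trans hx) hx' (by omega : 1 ≤ N) hψ.le
      rw [mul_div_cancel₀ _ hN0.ne', h] at this
      have h5 := le_of_mul_le_mul_right this sN
      exact absurd h5 (not_le.2 (Real.sin_lt_sin_of_lt_of_le_pi_div_two
        (by linarith) (by linarith) hx))
    · nlinarith
  · rintro ⟨h1, h2⟩
    have hx1 : γ / N ≤ δ := by rw [div_le_iff₀ hN0]; linarith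
    have hx2 : δ ≤ (Real.pi - γ) / N := by rw [le_div_iff₀ hN0]; linarith
    have hx3 : (Real.pi - γ) / N < Real.pi / 2 := by rw [div_lt_iff₀ hN0]; nlinarith
    have hc : ContinuousOn (fun ψ => Real.sin ψ * Real.sin γ - Real.sin δ * Real.sin (N * ψ))
      (Icc (γ / N) ((Real.pi - γ) / N)) := by fun_prop
    obtain ⟨ψ, ⟨hψ1, hψ2⟩, hψ⟩ := intermediate_value_Icc (hx1.trans hx2) hc
      (show (0 : ℝ) ∈ _ from ⟨by
        have := Real.sin_le_sin_of_le_of_le_pi_div_two (x := γ / N) (y := δ)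
          (by linarith [div_pos hγ hN0]) (by linarith) hx1
        simp only [mul_div_cancel₀ _ hN0.ne']
        nlinarith, by
        have := Real.sin_le_sin_of_le_of_le_pi_div_two (x := δ) (y := (Real.pi - γ) / N)
          (by linarith) hx3.le hx2
        simp only [mul_div_cancel₀ _ hN0.ne', Real.sin_pi_sub]
        nlinarith⟩)
    have hψ0 : 0 < ψ := (div_pos hγ hN0).trans_le hψ1
    rw [div_le_iff₀ hN0] at hψ1
    have hψ2' := hψ2
    rw [le_div_iff₀ hN0] at hψ2'
    simp only at hψ
    have hs : Real.sin γ ≤ Real.sin (N * ψ) := by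
      rcases le_total (N * ψ) (Real.pi / 2) with h | h
      · exact Real.sin_le_sin_of_le_of_le_pi_div_two (by linarith) h (by linarith)
      · rw [← Real.sin_pi_sub (N * ψ)]
        exact Real.sin_le_sin_of_le_of_le_pi_div_two (by linarith) (by linarith) (by linarith)
    refine ⟨ψ, hψ0, by linarith, ?_, by linarith⟩
    by_contra! hlt
    have := Real.sin_lt_sin_of_lt_of_le_pi_div_two (by linarith) hδ'.le hlt
    have sψ := Real.sin_pos_of_pos_of_lt_pi hψ0 (by linarith)
    nlinarith

/-! ### Elastic collisions in relative coordinates -/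

section
variable {E : Type*} [NormedAddCommGroup E] [InnerProductSpace ℝ E]

/-- The share of particle `i` in the mass of the pair formed by particles `0` and `i`. -/
noncomputable def massRatio (m : Fin 3 → ℝ) (i : Fin 3) : ℝ := m i / (m 0 + m i)

lemma word32_add_two (k : ℕ) : word32 (k + 2) = word32 k := by
  simp [word32, Nat.even_add]

lemma word32_ne_zero (k : ℕ) : word32 k ≠ 0 := by
  unfold word32; split_ifs <;> decide

lemma word32_succ_ne (k : ℕ) : word32 (k + 1) ≠ word32 k := by
  by_cases h : Even k <;> simp [word32, Nat.even_add_one, h]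

lemma sum_eq_add_add {M : Type*} [AddCommMonoid M] {s t : Fin 3} (hs : s ≠ 0) (ht : t ≠ 0)
    (hts : t ≠ s) (f : Fin 3 → M) : ∑ i, f i = f 0 + f t + f s := by
  rw [Fin.sum_univ_three]
  fin_cases s <;> fin_cases t <;> simp_all [add_right_comm]

/-- The kinetic energy of a pair is that of its centre of mass plus that of the relative motion. -/
lemma kinetic_energy_split {p q : ℝ} (hp : 0 < p) (hq : 0 < q) (x y : E) :
    (p + q) * (p * ‖x‖ ^ 2 + q * ‖y‖ ^ 2) = ‖p • x + q • y‖ ^ 2 + p * q * ‖x - y‖ ^ 2 := by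
  rw [norm_add_sq_real, norm_sub_sq_real, norm_smul, norm_smul, real_inner_smul_left,
    real_inner_smul_right, Real.norm_of_nonneg hp.le, Real.norm_of_nonneg hq.le]
  ring

lemma isElasticCollision_iff {m : Fin 3 → ℝ} (hm : ∀ i, 0 < m i) {s t : Fin 3} (hs : s ≠ 0)
    (ht : t ≠ 0) (hts : t ≠ s) {v v' : Fin 3 → E} :
    IsElasticCollision m s v v' ↔ v' s = v s ∧
      m 0 • v' 0 + m t • v' t = m 0 • v 0 + m t • v t ∧ ‖v' 0 - v' t‖ = ‖v 0 - v t‖ := by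
  have k := kinetic_energy_split (hm 0) (hm t) (v 0) (v t)
  have k' := kinetic_energy_split (hm 0) (hm t) (v' 0) (v' t)
  have hpq := mul_pos (hm 0) (hm t)
  have hadd := add_pos (hm 0) (hm t)
  constructor
  · rintro ⟨h1, h2, h3⟩
    rw [sum_eq_add_add hs ht hts, sum_eq_add_add hs ht hts, h1] at h2 h3
    have h2' := add_right_cancel h2
    refine ⟨h1, h2', ?_⟩
    rw [h2'] at k'
    refine (pow_left_inj₀ (norm_nonneg _) (norm_nonneg _) two_ne_zero).1
      (mul_left_cancel₀ hpq.ne' ?_)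
    linear_combination k - k' + 2 * (m 0 + m t) * h3
  · rintro ⟨h1, h2, h3⟩
    refine ⟨h1, ?_, ?_⟩
    · rw [sum_eq_add_add hs ht hts, sum_eq_add_add hs ht hts, h1, h2]
    · rw [sum_eq_add_add hs ht hts, sum_eq_add_add hs ht hts, h1]
      rw [h2, h3] at k'
      refine mul_left_cancel₀ hadd.ne' ?_
      linear_combination (k' - k) / 2

/-- The velocity of the centre of mass of the colliding pair `0, t` relative to the spectator `s` is
conserved. -/
lemma IsElasticCollision.relative {m : Fin 3 → ℝ} (hm : ∀ i, 0 < m i) {s t : Fin 3} (hs : s ≠ 0)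
    (ht : t ≠ 0) (hts : t ≠ s) {v v' : Fin 3 → E} (h : IsElasticCollision m s v v') :
    (v' 0 - v' s) - massRatio m t • (v' 0 - v' t) = (v 0 - v s) - massRatio m t • (v 0 - v t) := by
  obtain ⟨h1, h2, -⟩ := (isElasticCollision_iff hm hs ht hts).1 h
  have hadd := add_pos (hm 0) (hm t)
  have aux : ∀ u : Fin 3 → E, (u 0 - u s) - massRatio m t • (u 0 - u t) =
      (m 0 + m t)⁻¹ • (m 0 • u 0 + m t • u t) - u s := by
    intro u
    have : massRatio m t = 1 - (m 0 + m t)⁻¹ * m 0 := by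
      unfold massRatio; field_simp; ring
    have h2 : (m 0 + m t)⁻¹ * m t = 1 - (m 0 + m t)⁻¹ * m 0 := by
      field_simp; ring
    rw [this, smul_add, smul_smul, smul_smul, h2]
    module
  rw [aux, aux, h1, h2]

/-- The configuration with centre of mass `V` and relative vectors `x 0 - x i = X i`; this reading
assumes `X 0 = 0`. It serves for positions and for velocities. -/
noncomputable def ofRelative (m : Fin 3 → ℝ) (V : E) (X : Fin 3 → E) (i : Fin 3) : E :=
  V + (∑ j, m j)⁻¹ • ∑ j, m j • X j - X i

lemma ofRelative_sub (m : Fin 3 → ℝ) (V : E) (X : Fin 3 → E) (i j : Fin 3) :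
    ofRelative m V X i - ofRelative m V X j = X j - X i := by
  simp [ofRelative]

lemma ofRelative_add_smul (m : Fin 3 → ℝ) (V W : E) (X Y : Fin 3 → E) (t : ℝ) (i : Fin 3) :
    ofRelative m (V + t • W) (X + t • Y) i = ofRelative m V X i + t • ofRelative m W Y i := by
  simp only [ofRelative, Pi.add_apply, Pi.smul_apply, smul_add, Finset.sum_add_distrib, smul_sub]
  have : ∑ j, m j • t • Y j = t • ∑ j, m j • Y j := by
    rw [Finset.smul_sum]
    exact Finset.sum_congr rfl fun j _ => smul_comm _ _ _
  rw [this, smul_comm t]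
  abel

lemma isElasticCollision_ofRelative {m : Fin 3 → ℝ} (hm : ∀ i, 0 < m i) {s t : Fin 3} (hs : s ≠ 0)
    (ht : t ≠ 0) (hts : t ≠ s) (V : E) {X X' : Fin 3 → E} (h0 : X 0 = 0) (h0' : X' 0 = 0)
    (h : X' s - massRatio m t • X' t = X s - massRatio m t • X t) (hn : ‖X' t‖ = ‖X t‖) :
    IsElasticCollision m s (ofRelative m V X) (ofRelative m V X') := by
  have hadd := add_pos (hm 0) (hm t)
  have hM : 0 < ∑ j, m j := by
    rw [sum_eq_add_add hs ht hts]; linarith [hm s]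
  have aux : ∀ Y : Fin 3 → E, Y 0 = 0 → ofRelative m V Y s =
      V - ((∑ j, m j)⁻¹ * (m 0 + m t)) • (Y s - massRatio m t • Y t) ∧
      m 0 • ofRelative m V Y 0 + m t • ofRelative m V Y t =
        (m 0 + m t) • V + ((∑ j, m j)⁻¹ * (m 0 + m t) * m s) • (Y s - massRatio m t • Y t) := by
    intro Y hY
    have e : ∑ j, m j • Y j = m t • Y t + m s • Y s := by
      rw [sum_eq_add_add hs ht hts, hY]; simp
    have e2 : (m 0 + m t) • massRatio m t • Y t = m t • Y t := by
      rw [smul_smul]; congr 1; unfold massRatio; field_simp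
    have e3 : ((∑ j, m j)⁻¹ * (m 0 + m t)) = 1 - (∑ j, m j)⁻¹ * m s := by
      field_simp; rw [sum_eq_add_add hs ht hts]; ring
    constructor
    · rw [ofRelative, e, smul_sub, mul_smul _ _ (massRatio m t • Y t), e2, e3]
      module
    · rw [ofRelative, ofRelative, e, hY, sub_zero, smul_sub (m t), ← e2]
      linear_combination (norm := module) e3 • ((m 0 + m t) • massRatio m t • Y t)
  obtain ⟨a1, a2⟩ := aux X h0
  obtain ⟨b1, b2⟩ := aux X' h0'
  refine (isElasticCollision_iff hm hs ht hts).2 ⟨?_, ?_, ?_⟩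
  · rw [a1, b1, h]
  · rw [a2, b2, h]
  · rw [ofRelative_sub, ofRelative_sub, h0, h0', sub_zero, sub_zero, hn]

/-! ### Chains of reflections -/

/-- The reduced form of a capture process with `N` collisions: `e k` is the direction of the vector
from particle 3 to particle 2 at collision `k`, and `ρ k` the relative speed of the pair that
collides there. The index `N` stands for a fictitious collision at infinite distance: `e N` is the
direction in which the pair of the last collision separates, and `ρ N = 0` says that the other pair
has been captured. The field `first` says that particles 2 and 3 are at rest initially. -/
structure IsCollisionChain (m : Fin 3 → ℝ) (N : ℕ) (e : ℕ → E) (ρ : ℕ → ℝ) : Prop where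
  norm_eq_one : ∀ k, k ≤ N → ‖e k‖ = 1
  pos : ∀ k, k < N → 0 < ρ k
  last : ρ N = 0
  reflect : ∀ k, k + 2 ≤ N →
    (ρ k + ρ (k + 2)) • e (k + 1) = (massRatio m (word32 k) * ρ (k + 1)) • (e k + e (k + 2))
  first : ‖ρ 1 • e 0 - (massRatio m 1 * ρ 0) • e 1‖ = (1 - massRatio m 1) * ρ 0

/-! ### From a capture process to a chain -/

namespace CollisionSequence

variable {m : Fin 3 → ℝ} {N : ℕ} (P : CollisionSequence E m N word32)

/-- The velocity between collisions `k` and `k + 1` at which the pair of collision `k` separates; the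
sign makes it a positive multiple of `gap (k + 1)`. -/
def separating (k : ℕ) : E :=
  (-1 : ℝ) ^ (k + 1) • (P.vel (k + 1) 0 - P.vel (k + 1) (word32 (k + 1)))

/-- The velocity between collisions `k` and `k + 1` at which the pair of collision `k + 1` approaches;
the sign makes it a positive multiple of `gap k`. -/
def approaching (k : ℕ) : E :=
  (-1 : ℝ) ^ (k + 1) • (P.vel (k + 1) 0 - P.vel (k + 1) (word32 k))

/-- The vector from particle 3 to particle 2 at collision `k`. -/
def gap (k : ℕ) : E := P.pos k 1 - P.pos k 2

lemma pos_word32 {k : ℕ} (hk : k < N) : P.pos k 0 - P.pos k (word32 k) = (-1 : ℝ) ^ k • P.gap k := by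
  unfold gap
  rcases Nat.even_or_odd k with h | h
  · have hw : word32 k = 2 := by simp [word32, h]
    rw [h.neg_one_pow, one_smul, hw, P.contact k hk 0 1 (by rw [hw]; decide) (by rw [hw]; decide)]
  · have hw : word32 k = 1 := by simp [word32, h]
    rw [h.neg_one_pow, hw, P.contact k hk 0 2 (by rw [hw]; decide) (by rw [hw]; decide)]
    module

lemma pos_partner {k : ℕ} (hk : k < N) : P.pos k 0 - P.pos k (word32 (k + 1)) = 0 :=
  sub_eq_zero.2 (P.contact k hk _ _ (word32_ne_zero k).symm (word32_succ_ne k))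

lemma smul_separating {k : ℕ} (hk : k + 1 < N) :
    (P.time (k + 1) - P.time k) • P.separating k = P.gap (k + 1) := by
  have h1 := P.pos_word32 hk
  rw [P.free k hk, P.free k hk, add_sub_add_comm, P.pos_partner (by omega), zero_add,
    ← smul_sub] at h1
  rw [separating, smul_comm, h1, smul_smul, ← pow_add, Even.neg_one_pow ⟨_, rfl⟩, one_smul]

lemma smul_approaching {k : ℕ} (hk : k + 1 < N) :
    (P.time (k + 1) - P.time k) • P.approaching k = P.gap k := by
  have h1 := P.pos_partner hk
  rw [P.free k hk, P.free k hk, add_sub_add_comm, word32_add_two, P.pos_word32 (by omega),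
    ← smul_sub, add_eq_zero_iff_eq_neg'] at h1
  rw [approaching, smul_comm, h1, smul_neg, smul_smul, ← pow_add,
    Odd.neg_one_pow ⟨k, by ring⟩, neg_one_smul, neg_neg]

lemma norm_separating_succ (hm : ∀ i, 0 < m i) {k : ℕ} (hk : k + 1 < N) :
    ‖P.separating (k + 1)‖ = ‖P.approaching k‖ := by
  have h := ((isElasticCollision_iff hm (word32_ne_zero _) (word32_ne_zero _)
    (word32_succ_ne (k + 1))).1 (P.elastic (k + 1) hk)).2.2
  rw [word32_add_two] at h
  rw [separating, approaching, norm_smul, norm_smul, word32_add_two, h]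
  simp

lemma separating_add_approaching (hm : ∀ i, 0 < m i) {k : ℕ} (hk : k + 1 < N) :
    P.separating k + P.approaching (k + 1) =
      massRatio m (word32 k) • (P.approaching k + P.separating (k + 1)) := by
  have h := (P.elastic (k + 1) hk).relative hm (word32_ne_zero _) (word32_ne_zero _)
    (word32_succ_ne (k + 1))
  rw [word32_add_two] at h
  simp only [separating, approaching, word32_add_two]
  have h' := congrArg (fun x => (-1 : ℝ) ^ (k + 1) • x) h
  rw [pow_succ _ (k + 1)]
  linear_combination (norm := module) -h'

/-- The unit vector along `gap k`, see `direction_eq`. For `k > 0` it is defined by the velocity after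
collision `k - 1`, which makes sense after the last collision too. -/
noncomputable def direction : ℕ → E
  | 0 => ‖P.gap 0‖⁻¹ • P.gap 0
  | k + 1 => ‖P.separating k‖⁻¹ • P.separating k

/-- The relative speed of the pair that collides at collision `k`: for `k = 0` measured after the
collision, for `k > 0` before it. -/
noncomputable def speed : ℕ → ℝ
  | 0 => ‖P.separating 0‖
  | k + 1 => ‖P.approaching k‖

section
variable {P}

lemma speed_eq (hm : ∀ i, 0 < m i) {k : ℕ} (hk : k < N) : P.speed k = ‖P.separating k‖ := by
  cases k with
  | zero => rfl
  | succ k => rw [P.norm_separating_succ hm hk]; rfl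

lemma norm_separating_zero (hm : ∀ i, 0 < m i) (hN : 2 ≤ N) (hP : P.IsCapture) :
    ‖P.separating 0‖ = ‖P.vel 0 0‖ := by
  have h := ((isElasticCollision_iff hm (word32_ne_zero _) (word32_ne_zero _)
    (word32_succ_ne 0)).1 (P.elastic 0 (by omega))).2.2
  have hw : word32 (0 + 1) = 1 := by simp [word32]
  rw [separating, norm_smul, h, hw, hP.rest_two]
  simp

lemma first_relation (hm : ∀ i, 0 < m i) (hN : 2 ≤ N) (hP : P.IsCapture) :
    P.approaching 0 - massRatio m 1 • P.separating 0 = -((1 - massRatio m 1) • P.vel 0 0) := by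
  have h := (P.elastic 0 (by omega)).relative hm (word32_ne_zero _) (word32_ne_zero _)
    (word32_succ_ne 0)
  have hw : word32 (0 + 1) = 1 := by simp [word32]
  have hw' : word32 0 = 2 := by simp [word32]
  simp only [hw, hw', hP.rest_two, hP.rest_three] at h
  simp only [separating, approaching, hw, hw']
  simp only [zero_add, pow_one] at h ⊢
  linear_combination (norm := module) -h

/-- No triple collision occurs, and no pair is at relative rest before the end. -/
lemma speed_pos_and_gap_ne (hm : ∀ i, 0 < m i) (hN : 2 ≤ N) (hP : P.IsCapture) {k : ℕ}
    (hk : k < N) : 0 < P.speed k ∧ P.gap k ≠ 0 := by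
  induction k with
  | zero =>
    refine ⟨?_, sub_ne_zero.2 hP.separated⟩
    rw [speed_eq hm hk, norm_separating_zero hm hN hP]
    exact norm_pos_iff.2 hP.incident
  | succ k ih =>
    obtain ⟨h1, h2⟩ := ih (by omega)
    rw [speed_eq hm (by omega), norm_pos_iff] at h1
    refine ⟨?_, ?_⟩
    · refine norm_pos_iff.2 fun h => h2 ?_
      rw [← P.smul_approaching hk, h, smul_zero]
    · rw [← P.smul_separating hk]
      exact smul_ne_zero (sub_pos.2 (P.time_lt k hk)).ne' h1

lemma direction_eq (hk : k < N) : P.direction k = ‖P.gap k‖⁻¹ • P.gap k := by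
  cases k with
  | zero => rfl
  | succ k =>
    have ht := sub_pos.2 (P.time_lt k hk)
    rw [← P.smul_separating hk, norm_smul, Real.norm_of_nonneg ht.le, mul_inv, smul_smul,
      mul_right_comm, inv_mul_cancel₀ ht.ne', one_mul]
    rfl

lemma separating_eq (hm : ∀ i, 0 < m i) {k : ℕ} (hk : k < N) :
    P.separating k = P.speed k • P.direction (k + 1) := by
  rw [speed_eq hm hk, direction, smul_smul]
  by_cases h : P.separating k = 0
  · simp [h]
  · rw [mul_inv_cancel₀ (norm_ne_zero_iff.2 h), one_smul]

lemma speed_last (hN : 2 ≤ N) (hNe : Even N) (hP : P.IsCapture) : P.speed N = 0 := by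
  obtain ⟨k, rfl⟩ : ∃ k, N = k + 1 := ⟨N - 1, by omega⟩
  have hw : word32 k = 1 := by
    rw [Nat.even_add_one] at hNe
    simp [word32, hNe]
  rw [speed, approaching, hw, hP.captured, sub_self, smul_zero, norm_zero]

lemma approaching_eq (hN : 2 ≤ N) (hNe : Even N) (hP : P.IsCapture) {k : ℕ} (hk : k < N) :
    P.approaching k = P.speed (k + 1) • P.direction k := by
  rcases (show k + 1 ≤ N by omega).eq_or_lt with h | h
  · have h0 : P.speed (k + 1) = 0 := by rw [h]; exact speed_last hN hNe hP
    rw [h0, zero_smul]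
    exact norm_eq_zero.1 h0
  · have ht := sub_pos.2 (P.time_lt k h)
    rw [direction_eq hk, speed, ← P.smul_approaching h, norm_smul, Real.norm_of_nonneg ht.le,
      mul_inv, smul_smul, smul_smul]
    by_cases h : P.approaching k = 0
    · simp [h]
    · have := norm_ne_zero_iff.2 h
      rw [show ‖P.approaching k‖ * ((P.time (k + 1) - P.time k)⁻¹ * ‖P.approaching k‖⁻¹) *
        (P.time (k + 1) - P.time k) = 1 by field_simp, one_smul]

lemma isCollisionChain (hm : ∀ i, 0 < m i) (hN : 2 ≤ N) (hNe : Even N) (hP : P.IsCapture) :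
    IsCollisionChain m N P.direction P.speed where
  norm_eq_one k hk := by
    cases k with
    | zero =>
      exact norm_smul_inv_norm (𝕜 := ℝ) (speed_pos_and_gap_ne hm hN hP (by omega : 0 < N)).2
    | succ k =>
      have := (speed_pos_and_gap_ne hm hN hP (by omega : k < N)).1
      rw [speed_eq hm (by omega), norm_pos_iff] at this
      exact norm_smul_inv_norm (𝕜 := ℝ) this
  pos k hk := (speed_pos_and_gap_ne hm hN hP hk).1
  last := speed_last hN hNe hP
  reflect k hk := by
    have := P.separating_add_approaching hm hk
    rw [separating_eq hm (by omega), separating_eq hm (by omega),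
      approaching_eq hN hNe hP (by omega), approaching_eq hN hNe hP (by omega)] at this
    rw [add_smul, this, mul_smul, smul_add (P.speed (k + 1))]
  first := by
    have h := first_relation hm hN hP
    have hr : massRatio m 1 < 1 := by
      rw [massRatio, div_lt_one (add_pos (hm 0) (hm 1))]; linarith [hm 0]
    have h' := congrArg norm h
    rw [separating_eq hm (by omega), approaching_eq hN hNe hP (by omega), smul_smul, norm_neg,
      norm_smul, Real.norm_of_nonneg (by linarith), ← norm_separating_zero hm hN hP] at h'
    exact h'

lemma vel_one_eq_iff (hm : ∀ i, 0 < m i) (hN : 2 ≤ N) (hNe : Even N) (hP : P.IsCapture) :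
    P.vel 1 = P.vel 0 ↔ P.direction 0 = P.direction 1 ∧ P.speed 0 = P.speed 1 := by
  have hc := isCollisionChain hm hN hNe hP
  have hr : massRatio m 1 < 1 := by
    rw [massRatio, div_lt_one (add_pos (hm 0) (hm 1))]; linarith [hm 0]
  have hw : word32 (0 + 1) = 1 := by simp [word32]
  have hw' : word32 0 = 2 := by simp [word32]
  have hsep : P.separating 0 = -(P.vel 1 0 - P.vel 1 1) := by
    rw [separating, hw]; simp
  have happ : P.approaching 0 = -(P.vel 1 0 - P.vel 1 2) := by
    rw [approaching, hw']; simp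
  constructor
  · intro h
    have e : P.approaching 0 = P.separating 0 := by
      rw [hsep, happ, h, hP.rest_two, hP.rest_three]
    have hs : P.speed 0 = P.speed 1 := by
      change ‖P.separating 0‖ = ‖P.approaching 0‖
      rw [e]
    refine ⟨?_, hs⟩
    rw [approaching_eq hN hNe hP (by omega), separating_eq hm (by omega), ← hs] at e
    exact smul_right_injective E (hc.pos 0 (by omega)).ne' e
  · rintro ⟨hd, hs⟩
    have e : P.approaching 0 = P.separating 0 := by
      rw [approaching_eq hN hNe hP (by omega), separating_eq hm (by omega), ← hs, ← hd]
    have h := first_relation hm hN hP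
    have h2 : P.separating 0 = - P.vel 0 0 := by
      refine smul_right_injective E (sub_pos.2 hr).ne' ?_
      rw [e] at h
      simp only
      rw [smul_neg, ← h]
      module
    have h3 : P.vel 1 2 = 0 := by
      have := (P.elastic 0 (by omega)).spectator
      rwa [hw', hP.rest_three] at this
    rw [e, h2, h3, sub_zero, neg_inj] at happ
    rw [h2, neg_inj, ← happ] at hsep
    funext i
    fin_cases i
    · exact happ.symm
    · simpa [hP.rest_two] using sub_eq_self.1 hsep.symm
    · simp [hP.rest_three, h3]

/-- Only the first collision can be trivial. -/
lemma vel_succ_ne (hm : ∀ i, 0 < m i) (hN : 2 ≤ N) (hNe : Even N) (hP : P.IsCapture) {k : ℕ}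
    (hk : k + 1 < N) : P.vel (k + 2) ≠ P.vel (k + 1) := by
  intro h
  have hc := isCollisionChain hm hN hNe hP
  have e : P.approaching k + P.separating (k + 1) = 0 := by
    rw [approaching, separating, word32_add_two, h, pow_succ _ (k + 1)]
    module
  have h2 := P.separating_add_approaching hm hk
  rw [e, smul_zero, separating_eq hm (by omega), approaching_eq hN hNe hP (by omega),
    ← add_smul] at h2
  have h3 := hc.norm_eq_one (k + 1) (by omega)
  rw [smul_eq_zero] at h2
  rcases h2 with h2 | h2
  · have p1 := hc.pos k (by omega)
    have p2 : 0 ≤ P.speed (k + 1 + 1) := norm_nonneg _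
    linarith
  · rw [h2] at h3; simp at h3

lemma scatteringAngle_succ (hm : ∀ i, 0 < m i) (hN : 2 ≤ N) (hNe : Even N) (hP : P.IsCapture)
    {k : ℕ} (hk : k + 1 < N) :
    P.scatteringAngle (k + 1) =
      InnerProductGeometry.angle (P.direction k) (-P.direction (k + 2)) := by
  have hc := isCollisionChain hm hN hNe hP
  have hp := hc.pos (k + 1) hk
  have h1 := approaching_eq hN hNe hP (by omega : k < N)
  have h2 := separating_eq (P := P) hm hk
  rw [← InnerProductGeometry.angle_smul_left_of_pos _ _ hp,
    ← InnerProductGeometry.angle_smul_right_of_pos _ _ hp, smul_neg, ← h1, ← h2, scatteringAngle]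
  rcases Nat.even_or_odd k with h | h
  · have hw : word32 k = 2 := by simp [word32, h]
    have hw' : word32 (k + 1) = 1 := by simp [word32, Nat.even_add_one, h]
    rw [approaching, separating, word32_add_two, hw, hw', pow_succ, pow_succ, pow_succ,
      h.neg_one_pow]
    congr 1
    · change P.vel (k + 1) 2 - P.vel (k + 1) 0 = _
      module
    · change P.vel (k + 2) 2 - P.vel (k + 2) 0 = _
      module
  · have hw : word32 k = 1 := by simp [word32, h]
    have hw' : word32 (k + 1) = 2 := by simp [word32, h]
    rw [approaching, separating, word32_add_two, hw, hw', pow_succ, pow_succ, pow_succ,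
      h.neg_one_pow]
    congr 1
    · change (P.vel (k + 1) 0 - P.vel (k + 1) 1) = _
      module
    · change (P.vel (k + 2) 0 - P.vel (k + 2) 1) = _
      module

end
end CollisionSequence

/-! ### Trigonometric solution of a chain -/

lemma massRatio_pos {m : Fin 3 → ℝ} (hm : ∀ i, 0 < m i) (i : Fin 3) : 0 < massRatio m i :=
  div_pos (hm i) (add_pos (hm 0) (hm i))

lemma massRatio_lt_one {m : Fin 3 → ℝ} (hm : ∀ i, 0 < m i) (i : Fin 3) : massRatio m i < 1 := by
  rw [massRatio, div_lt_one (add_pos (hm 0) (hm i))]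
  linarith [hm 0]

lemma massRatio_one {m : Fin 3 → ℝ} (hm : ∀ i, 0 < m i) :
    massRatio m 1 = 1 / (m 0 / m 1 + 1) := by
  have := hm 0
  have := hm 1
  unfold massRatio
  field_simp

lemma massRatio_two {m : Fin 3 → ℝ} (hm : ∀ i, 0 < m i) :
    massRatio m 2 = m 2 / m 1 / (m 0 / m 1 + m 2 / m 1) := by
  have := hm 0
  have := hm 1
  have := hm 2
  unfold massRatio
  field_simp

/-- The factor `d k` by which the speeds `ρ k` deviate from a solution of a recurrence with constant
coefficients; it depends on the parity of `k` only. -/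
noncomputable def massWeight (m : Fin 3 → ℝ) (k : ℕ) : ℝ := √(massRatio m (word32 k))

lemma massWeight_pos {m : Fin 3 → ℝ} (hm : ∀ i, 0 < m i) (k : ℕ) : 0 < massWeight m k :=
  Real.sqrt_pos.2 (massRatio_pos hm _)

lemma massWeight_sq {m : Fin 3 → ℝ} (hm : ∀ i, 0 < m i) (k : ℕ) :
    massWeight m k ^ 2 = massRatio m (word32 k) := Real.sq_sqrt (massRatio_pos hm _).le

lemma massWeight_add_two (m : Fin 3 → ℝ) (k : ℕ) : massWeight m (k + 2) = massWeight m k := by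
  rw [massWeight, word32_add_two, massWeight]

lemma massWeight_mul_succ {m : Fin 3 → ℝ} (hm : ∀ i, 0 < m i) (k : ℕ) :
    massWeight m k * massWeight m (k + 1) = Real.cos (angleOne (m 0 / m 1) (m 2 / m 1)) := by
  have ha := div_pos (hm 0) (hm 1)
  have hb := div_pos (hm 2) (hm 1)
  have h12 : √(massRatio m 2) * √(massRatio m 1) =
      Real.cos (angleOne (m 0 / m 1) (m 2 / m 1)) := by
    rw [(angleOne_spec ha hb).1, massRatio_one hm, massRatio_two hm, Real.sqrt_div hb.le,
      Real.sqrt_div zero_le_one, Real.sqrt_one, div_mul_div_comm, mul_one]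
  unfold massWeight
  by_cases h : Even k
  · simpa [word32, Nat.even_add_one, h] using h12
  · simpa [word32, Nat.even_add_one, h, mul_comm] using h12

lemma massWeight_zero_mul_sin {m : Fin 3 → ℝ} (hm : ∀ i, 0 < m i) :
    massWeight m 0 * Real.sin (angleTwo (m 0 / m 1) (m 2 / m 1)) =
      massWeight m 1 * Real.sin (angleThree (m 0 / m 1) (m 2 / m 1)) := by
  have ha := div_pos (hm 0) (hm 1)
  have hb := div_pos (hm 2) (hm 1)
  have h0 : massWeight m 0 = √(massRatio m 2) := by simp [massWeight, word32]
  have h1 : massWeight m 1 = √(massRatio m 1) := by simp [massWeight, word32]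
  rw [h0, h1, (angleTwo_spec ha hb).2.1, (angleThree_spec ha hb).2.1, massRatio_one hm,
    massRatio_two hm, Real.sqrt_div hb.le, Real.sqrt_div zero_le_one, Real.sqrt_one]
  field_simp

lemma sin_angleOne_sq {a b : ℝ} (ha : 0 < a) (hb : 0 < b) :
    Real.sin (angleOne a b) ^ 2 = a * (1 + b) / (a + b) * Real.sin (angleTwo a b) ^ 2 := by
  rw [(angleOne_spec ha hb).2.1, (angleTwo_spec ha hb).2.1, div_pow, div_pow, mul_pow, mul_pow,
    mul_pow, Real.sq_sqrt (by positivity), Real.sq_sqrt (by positivity),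
    Real.sq_sqrt (by positivity), Real.sq_sqrt (by positivity), Real.sq_sqrt (by positivity)]
  field_simp
  ring

lemma massWeight_sq_identity {m : Fin 3 → ℝ} (hm : ∀ i, 0 < m i) :
    Real.sin (angleOne (m 0 / m 1) (m 2 / m 1)) ^ 2 * massWeight m 1 ^ 2 =
      (massWeight m 1 ^ 2 + (1 - 2 * massWeight m 1 ^ 2) * massWeight m 0 ^ 2) *
        Real.sin (angleTwo (m 0 / m 1) (m 2 / m 1)) ^ 2 := by
  have h0 : massWeight m 0 ^ 2 = massRatio m 2 := by simp [massWeight_sq hm, word32]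
  have h1 : massWeight m 1 ^ 2 = massRatio m 1 := by simp [massWeight_sq hm, word32]
  have p0 := hm 0
  have p1 := hm 1
  have p2 := hm 2
  rw [h0, h1, sin_angleOne_sq (div_pos p0 p1) (div_pos p2 p1), massRatio, massRatio]
  field_simp
  ring

lemma norm_first_iff {e f : E} (he : ‖e‖ = 1) (hf : ‖f‖ = 1) {x y ν : ℝ} (hν : ν ≤ 1)
    (hx : 0 ≤ x) : ‖y • e - (ν * x) • f‖ = (1 - ν) * x ↔
      y ^ 2 - 2 * ν * x * y * inner ℝ e f = (1 - 2 * ν) * x ^ 2 := by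
  have h : ‖y • e - (ν * x) • f‖ ^ 2 = y ^ 2 - 2 * ν * x * y * inner ℝ e f + (ν * x) ^ 2 := by
    rw [norm_sub_sq_real, norm_smul, norm_smul, he, hf, real_inner_smul_left,
      real_inner_smul_right, Real.norm_eq_abs, Real.norm_eq_abs, mul_one, mul_one, sq_abs, sq_abs]
    ring
  rw [← pow_left_inj₀ (norm_nonneg _) (mul_nonneg (sub_nonneg.2 hν) hx) two_ne_zero, h]
  constructor <;> intro h' <;> linear_combination h'

/-- If a positive multiple of `e + f` is a positive multiple of `d`, then `d` bisects the angle of the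
unit vectors `e` and `f`. -/
lemma inner_of_reflect {d e f : E} (hd : ‖d‖ = 1) (he : ‖e‖ = 1) (hf : ‖f‖ = 1) {A B : ℝ}
    (hA : 0 < A) (hB : 0 < B) (h : A • d = B • (e + f)) :
    inner ℝ d f = inner ℝ e d ∧ A = 2 * B * inner ℝ e d ∧
      1 + inner ℝ e f = 2 * inner ℝ e d ^ 2 := by
  have h1 := congrArg (fun x => inner ℝ d x) h
  have h2 := congrArg (fun x => inner ℝ e x) h
  have h3 := congrArg (fun x => inner ℝ f x) h
  simp only [real_inner_smul_right, inner_add_right, real_inner_self_eq_norm_sq, hd, he,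
    hf] at h1 h2 h3
  rw [real_inner_comm e d] at h1
  rw [real_inner_comm d f, real_inner_comm e f] at h3
  have h4 : inner ℝ d f = inner ℝ e d := mul_left_cancel₀ hA.ne' (by linear_combination h3 - h2)
  have h5 : A = 2 * B * inner ℝ e d := by rw [h4] at h1; linear_combination h1
  refine ⟨h4, h5, mul_left_cancel₀ hB.ne' ?_⟩
  linear_combination inner ℝ e d * h5 - h2

namespace IsCollisionChain
variable {m : Fin 3 → ℝ} {N : ℕ} {e : ℕ → E} {ρ : ℕ → ℝ}

lemma nonneg (h : IsCollisionChain m N e ρ) {k : ℕ} (hk : k ≤ N) : 0 ≤ ρ k := by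
  rcases hk.eq_or_lt with rfl | hk
  · exact h.last.ge
  · exact (h.pos k hk).le

lemma step (hm : ∀ i, 0 < m i) (h : IsCollisionChain m N e ρ) {k : ℕ} (hk : k + 2 ≤ N) :
    inner ℝ (e (k + 1)) (e (k + 2)) = inner ℝ (e k) (e (k + 1)) ∧
      ρ k + ρ (k + 2) = 2 * (massRatio m (word32 k) * ρ (k + 1)) * inner ℝ (e k) (e (k + 1)) ∧
      1 + inner ℝ (e k) (e (k + 2)) = 2 * inner ℝ (e k) (e (k + 1)) ^ 2 :=
  inner_of_reflect (h.norm_eq_one _ (by omega)) (h.norm_eq_one _ (by omega))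
    (h.norm_eq_one _ hk) (add_pos_of_pos_of_nonneg (h.pos _ (by omega)) (h.nonneg hk))
    (mul_pos (massRatio_pos hm _) (h.pos _ (by omega))) (h.reflect k hk)

lemma inner_eq (hm : ∀ i, 0 < m i) (h : IsCollisionChain m N e ρ) {k : ℕ} (hk : k + 1 ≤ N) :
    inner ℝ (e k) (e (k + 1)) = inner ℝ (e 0) (e 1) := by
  induction k with
  | zero => rfl
  | succ k ih => rw [(h.step hm hk).1, ih (by omega)]

lemma inner_pos (hm : ∀ i, 0 < m i) (hN : 2 ≤ N) (h : IsCollisionChain m N e ρ) :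
    0 < inner ℝ (e 0) (e 1) := by
  have h1 := (h.step hm (k := 0) hN).2.1
  have h2 := h.pos 0 (by omega)
  have h3 := h.nonneg hN
  have h4 := mul_pos (massRatio_pos hm (word32 0)) (h.pos 1 (by omega))
  by_contra! h5
  nlinarith

lemma inner_le_one (hN : 2 ≤ N) (h : IsCollisionChain m N e ρ) : inner ℝ (e 0) (e 1) ≤ 1 := by
  have := real_inner_le_norm (e 0) (e 1)
  rwa [h.norm_eq_one 0 (by omega), h.norm_eq_one 1 (by omega), mul_one] at this

/-- The speeds are determined by the recurrence downwards from `ρ N = 0` and `ρ (N - 1)`. -/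
lemma speed_formula (hm : ∀ i, 0 < m i) (h : IsCollisionChain m N e ρ) {ψ : ℝ}
    (hψ : Real.cos ψ =
      Real.cos (angleOne (m 0 / m 1) (m 2 / m 1)) * inner ℝ (e 0) (e 1)) (j : ℕ) :
    ∀ i, i + j = N → ρ i * (massWeight m (N - 1) * Real.sin ψ) =
      ρ (N - 1) * (massWeight m i * Real.sin (j * ψ)) := by
  induction j using Nat.twoStepInduction with
  | zero =>
    intro i hi
    obtain rfl : i = N := hi
    simp [h.last]
  | one => rintro i rfl; simp
  | more j ih1 ih2 =>
    intro i hi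
    have h1 := ih1 (i + 2) (by omega)
    have h2 := ih2 (i + 1) (by omega)
    have h3 := (h.step hm (k := i) (by omega)).2.1
    rw [h.inner_eq hm (by omega), ← massWeight_sq hm] at h3
    rw [massWeight_add_two] at h1
    have hw := massWeight_mul_succ hm i
    have hs : Real.sin ((j + 2 : ℕ) * ψ) =
        2 * Real.cos ψ * Real.sin ((j + 1 : ℕ) * ψ) - Real.sin (j * ψ) := by
      push_cast
      rw [show ((j : ℝ) + 2) * ψ = (j + 1) * ψ + ψ by ring,
        show (j : ℝ) * ψ = (j + 1) * ψ - ψ by ring, Real.sin_add, Real.sin_sub]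
      ring
    rw [hs, hψ, ← hw]
    linear_combination massWeight m (N - 1) * Real.sin ψ * h3 - h1 +
      2 * massWeight m i ^ 2 * inner ℝ (e 0) (e 1) * h2

end IsCollisionChain

lemma mul_lt_pi_of_sin_pos {N : ℕ} {ψ : ℝ} (hψ : 0 < ψ) (hψ' : ψ < Real.pi / 2)
    (h : ∀ j : ℕ, 1 ≤ j → j ≤ N → 0 < Real.sin (j * ψ)) : N * ψ < Real.pi := by
  have key : ∀ j : ℕ, j ≤ N → j * ψ < Real.pi := by
    intro j
    induction j with
    | zero => intro; simpa using Real.pi_pos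
    | succ j ih =>
      intro hj
      have h1 := ih (by omega)
      have h2 := h (j + 1) (by omega) hj
      by_contra! h3
      push_cast at h2 h3
      have : 0 ≤ Real.sin ((j + 1) * ψ - Real.pi) :=
        Real.sin_nonneg_of_nonneg_of_le_pi (by linarith) (by linarith)
      rw [Real.sin_sub_pi] at this
      linarith
  exact key N le_rfl

/-- The quadratic form `x² - 2 x y cos ψ + y²` is constant along `sin (k ψ)`. -/
lemma sin_pred_mul_identity (N ψ : ℝ) :
    Real.sin ((N - 1) * ψ) ^ 2 - 2 * Real.cos ψ * Real.sin (N * ψ) * Real.sin ((N - 1) * ψ) =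
      Real.sin ψ ^ 2 - Real.sin (N * ψ) ^ 2 := by
  rw [show (N - 1) * ψ = N * ψ - ψ by ring, Real.sin_sub]
  linear_combination Real.sin ψ ^ 2 * Real.sin_sq_add_cos_sq (N * ψ) -
    Real.sin (N * ψ) ^ 2 * Real.sin_sq_add_cos_sq ψ

/-- The angle `ψ` of a chain. Its equation is the condition `first`, rewritten by means of the formula
for the speeds. -/
lemma IsCollisionChain.exists_angle {m : Fin 3 → ℝ} {N : ℕ} {e : ℕ → E} {ρ : ℕ → ℝ}
    (hm : ∀ i, 0 < m i) (hN : 2 ≤ N) (h : IsCollisionChain m N e ρ) :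
    ∃ ψ, 0 < ψ ∧ N * ψ < Real.pi ∧ angleOne (m 0 / m 1) (m 2 / m 1) ≤ ψ ∧
      Real.sin ψ * Real.sin (angleTwo (m 0 / m 1) (m 2 / m 1)) =
        Real.sin (angleOne (m 0 / m 1) (m 2 / m 1)) * Real.sin (N * ψ) ∧
      Real.cos ψ = Real.cos (angleOne (m 0 / m 1) (m 2 / m 1)) * inner ℝ (e 0) (e 1) ∧
      ρ 0 * (massWeight m 1 * Real.sin ((N - 1) * ψ)) =
        ρ 1 * (massWeight m 0 * Real.sin (N * ψ)) := by
  have ha := div_pos (hm 0) (hm 1)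
  have hb := div_pos (hm 2) (hm 1)
  have hf := fun ψ => h.speed_formula hm (ψ := ψ)
  have hw := massWeight_mul_succ hm 0
  have hid := massWeight_sq_identity hm
  obtain ⟨-, -, p1, q1⟩ := angleOne_spec ha hb
  obtain ⟨-, -, p2, q2⟩ := angleTwo_spec ha hb
  set δ := angleOne (m 0 / m 1) (m 2 / m 1)
  set γ := angleTwo (m 0 / m 1) (m 2 / m 1)
  have hc0 := h.inner_pos hm hN
  have hc1 := h.inner_le_one hN
  set c : ℝ := inner ℝ (e 0) (e 1) with hc
  have cδ := Real.cos_pos_of_mem_Ioo (x := δ) ⟨by linarith, q1⟩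
  have cδ1 : Real.cos δ < 1 := by
    rw [← Real.cos_zero]
    exact Real.cos_lt_cos_of_nonneg_of_le_pi le_rfl (by linarith) p1
  have hx0 : 0 < Real.cos δ * c := mul_pos cδ hc0
  have hx1 : Real.cos δ * c ≤ Real.cos δ := by nlinarith
  obtain ⟨ψ, hψdef⟩ : ∃ ψ, ψ = Real.arccos (Real.cos δ * c) := ⟨_, rfl⟩
  have hψ : Real.cos ψ = Real.cos δ * c := by
    rw [hψdef, Real.cos_arccos (by linarith) (by linarith)]
  have hψ0 : 0 < ψ := by rw [hψdef]; exact Real.arccos_pos.2 (by linarith)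
  have hψ2 : ψ < Real.pi / 2 := by rw [hψdef]; exact Real.arccos_lt_pi_div_two.2 hx0
  have sψ := Real.sin_pos_of_pos_of_lt_pi hψ0 (by linarith)
  have hX : 0 < massWeight m (N - 1) * Real.sin ψ := mul_pos (massWeight_pos hm _) sψ
  have hC := h.pos (N - 1) (by omega)
  have hpos : ∀ j : ℕ, 1 ≤ j → j ≤ N → 0 < Real.sin (j * ψ) := by
    intro j hj hjN
    have h1 := hf ψ hψ j (N - j) (by omega)
    have h2 := mul_pos (h.pos (N - j) (by omega)) hX
    rw [h1] at h2
    exact pos_of_mul_pos_right (pos_of_mul_pos_right h2 hC.le) (massWeight_pos hm _).le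
  have hNψ := mul_lt_pi_of_sin_pos hψ0 hψ2 hpos
  have f0 := hf ψ hψ N 0 (by omega)
  have f1 := hf ψ hψ (N - 1) 1 (by omega)
  rw [Nat.cast_sub (by omega), Nat.cast_one] at f1
  have hrel : ρ 0 * (massWeight m 1 * Real.sin ((N - 1) * ψ)) =
      ρ 1 * (massWeight m 0 * Real.sin (N * ψ)) := by
    refine mul_left_cancel₀ hX.ne' ?_
    linear_combination massWeight m 1 * Real.sin ((N - 1) * ψ) * f0 -
      massWeight m 0 * Real.sin (N * ψ) * f1
  refine ⟨ψ, hψ0, hNψ, ?_, ?_, hψ, hrel⟩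
  · by_contra! hlt
    have := Real.cos_lt_cos_of_nonneg_of_le_pi hψ0.le (by linarith) hlt
    linarith
  · have sN := hpos N (by omega) le_rfl
    have sγ := Real.sin_pos_of_pos_of_lt_pi p2 (by linarith)
    have sδ := Real.sin_pos_of_pos_of_lt_pi p1 (by linarith)
    have hfirst := (norm_first_iff (h.norm_eq_one 0 (by omega)) (h.norm_eq_one 1 (by omega))
      (massRatio_lt_one hm 1).le (h.pos 0 (by omega)).le).1 h.first
    rw [← hc, show massRatio m 1 = massWeight m 1 ^ 2 by simp [massWeight_sq hm, word32]] at hfirst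
    have hS := sin_pred_mul_identity N ψ
    have w1 := massWeight_pos hm 1
    simp only [zero_add] at hw
    have hρ0 := h.pos 0 (by omega)
    have key : Real.sin ψ ^ 2 * massWeight m 1 ^ 2 =
        (massWeight m 1 ^ 2 + (1 - 2 * massWeight m 1 ^ 2) * massWeight m 0 ^ 2) *
          Real.sin (N * ψ) ^ 2 := by
      refine mul_left_cancel₀ (pow_ne_zero 2 hρ0.ne') ?_
      rw [hψ, ← hw] at hS
      linear_combination massWeight m 0 ^ 2 * Real.sin (N * ψ) ^ 2 * hfirst
        - ρ 0 ^ 2 * massWeight m 1 ^ 2 * hS +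
        (ρ 0 * (massWeight m 1 * Real.sin ((N - 1) * ψ)) +
          ρ 1 * (massWeight m 0 * Real.sin (N * ψ)) -
          2 * massWeight m 1 ^ 2 * c * ρ 0 * massWeight m 0 * Real.sin (N * ψ)) * hrel
    refine (pow_left_inj₀ (by positivity) (by positivity) two_ne_zero).1
      (mul_left_cancel₀ (pow_ne_zero 2 w1.ne') ?_)
    linear_combination Real.sin γ ^ 2 * key - Real.sin (N * ψ) ^ 2 * hid

/-- The first collision is trivial exactly on `C_{2n-1}`. -/
lemma IsCollisionChain.trivial_iff {m : Fin 3 → ℝ} {N : ℕ} {e : ℕ → E} {ρ : ℕ → ℝ}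
    (hm : ∀ i, 0 < m i) (hN : 2 ≤ N) (h : IsCollisionChain m N e ρ) :
    (e 0 = e 1 ∧ ρ 0 = ρ 1) ↔ angleTwo (m 0 / m 1) (m 2 / m 1) +
      N * angleOne (m 0 / m 1) (m 2 / m 1) = Real.pi := by
  have ha := div_pos (hm 0) (hm 1)
  have hb := div_pos (hm 2) (hm 1)
  obtain ⟨ψ, hψ0, hNψ, hδψ, hsin, hcos, hrel⟩ := h.exists_angle hm hN
  have hww := massWeight_zero_mul_sin hm
  have hsum := angle_sum ha hb
  obtain ⟨-, -, p1, q1⟩ := angleOne_spec ha hb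
  obtain ⟨-, -, p2, q2⟩ := angleTwo_spec ha hb
  obtain ⟨-, -, p3, q3⟩ := angleThree_spec ha hb
  set δ := angleOne (m 0 / m 1) (m 2 / m 1)
  set γ := angleTwo (m 0 / m 1) (m 2 / m 1)
  set ε := angleThree (m 0 / m 1) (m 2 / m 1)
  have hN' : (2 : ℝ) ≤ N := by exact_mod_cast hN
  have sγ := Real.sin_pos_of_pos_of_lt_pi p2 (by linarith)
  have sδ := Real.sin_pos_of_pos_of_lt_pi p1 (by linarith)
  have sε := Real.sin_pos_of_pos_of_lt_pi p3 (by linarith)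
  have n0 := h.norm_eq_one 0 (by omega)
  have n1 := h.norm_eq_one 1 (by omega)
  have w1 := massWeight_pos hm 1
  have w0 := massWeight_pos hm 0
  constructor
  · rintro ⟨he, hρ⟩
    rw [← he, real_inner_self_eq_norm_sq, n0, one_pow, mul_one] at hcos
    have hψ : ψ = δ := Real.injOn_cos ⟨hψ0.le, by nlinarith⟩ ⟨p1.le, by linarith⟩ hcos
    rw [hψ] at hrel hNψ
    rw [hρ] at hrel
    have hrel' := mul_left_cancel₀ (h.pos 1 (by omega)).ne' hrel
    have hsε : Real.sin ε = Real.sin (γ + δ) := by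
      rw [← Real.sin_pi_sub]; congr 1; linarith
    -- with `ψ = δ` the equality of the first two speeds amounts to `sin δ * sin (γ + N δ) = 0`
    have e1 : Real.sin ((N - 1) * δ) * Real.sin γ = Real.sin (γ + δ) * Real.sin (N * δ) := by
      refine mul_left_cancel₀ w1.ne' ?_
      rw [← hsε]
      linear_combination Real.sin γ * hrel' + Real.sin (N * δ) * hww
    have e2 : Real.sin (γ + N * δ) = 0 := by
      refine mul_left_cancel₀ sδ.ne' ?_
      rw [show (N - 1) * δ = N * δ - δ by ring, Real.sin_sub, Real.sin_add] at e1
      rw [Real.sin_add]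
      linear_combination -e1
    rcases lt_trichotomy (γ + N * δ) Real.pi with hlt | heq | hgt
    · exact absurd e2 (Real.sin_pos_of_pos_of_lt_pi (by positivity) hlt).ne'
    · exact heq
    · have := Real.sin_pos_of_pos_of_lt_pi (x := γ + N * δ - Real.pi) (by linarith) (by linarith)
      rw [Real.sin_sub_pi, e2] at this
      simp at this
  · intro hodd
    have hNδ : N * δ = Real.pi - γ := by linarith
    have hψ : ψ = δ := eq_of_sin_mul_eq hN hψ0 p1 hNψ (by linarith) sδ.ne' hsin
      (by rw [hNδ, Real.sin_pi_sub])
    rw [hψ] at hcos hrel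
    have hc : inner ℝ (e 0) (e 1) = 1 := by
      have cδ := Real.cos_pos_of_mem_Ioo (x := δ) ⟨by linarith, q1⟩
      exact mul_left_cancel₀ cδ.ne' (by linarith)
    refine ⟨(inner_eq_one_iff_of_norm_eq_one n0 n1).1 hc, ?_⟩
    rw [show (N - 1) * δ = ε by linarith, hNδ, Real.sin_pi_sub, hww] at hrel
    exact mul_right_cancel₀ (by positivity) hrel

/-! ### From an angle to a chain and to a capture process -/

lemma exists_orthonormal_pair (hE : 1 < Module.rank ℝ E) :
    ∃ x y : E, ‖x‖ = 1 ∧ ‖y‖ = 1 ∧ inner ℝ x y = 0 := by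
  have : Nontrivial E := by
    rw [← rank_pos_iff_nontrivial (R := ℝ)]
    exact zero_lt_one.trans hE
  obtain ⟨x, hx⟩ := exists_ne (0 : E)
  obtain ⟨y, hxy⟩ := exists_linearIndependent_pair_of_one_lt_rank hE hx
  have h := InnerProductSpace.gramSchmidtNormed_orthonormal hxy
  exact ⟨_, _, h.1 0, h.1 1, h.2 zero_ne_one⟩

/-- The chain turns by a constant angle `φ`, with `cos φ = cos ψ / cos δ`, in a plane of `E`. -/
lemma exists_chain (hE : 1 < Module.rank ℝ E) {m : Fin 3 → ℝ} {N : ℕ} (hm : ∀ i, 0 < m i)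
    (hN : 2 ≤ N) {ψ : ℝ} (hψ0 : 0 < ψ) (hNψ : N * ψ < Real.pi)
    (hδψ : angleOne (m 0 / m 1) (m 2 / m 1) ≤ ψ)
    (hsin : Real.sin ψ * Real.sin (angleTwo (m 0 / m 1) (m 2 / m 1)) =
        Real.sin (angleOne (m 0 / m 1) (m 2 / m 1)) * Real.sin (N * ψ)) :
    ∃ (e : ℕ → E) (ρ : ℕ → ℝ), IsCollisionChain m N e ρ := by
  have ha := div_pos (hm 0) (hm 1)
  have hb := div_pos (hm 2) (hm 1)
  have hw := massWeight_mul_succ hm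
  have hid := massWeight_sq_identity hm
  obtain ⟨-, -, p1, q1⟩ := angleOne_spec ha hb
  obtain ⟨-, -, p2, q2⟩ := angleTwo_spec ha hb
  set δ := angleOne (m 0 / m 1) (m 2 / m 1)
  set γ := angleTwo (m 0 / m 1) (m 2 / m 1)
  have hN' : (2 : ℝ) ≤ N := by exact_mod_cast hN
  have hψ2 : ψ < Real.pi / 2 := by nlinarith
  have sγ := Real.sin_pos_of_pos_of_lt_pi p2 (by linarith)
  have cδ := Real.cos_pos_of_mem_Ioo (x := δ) ⟨by linarith, q1⟩
  have cψ := Real.cos_pos_of_mem_Ioo (x := ψ) ⟨by linarith, hψ2⟩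
  have hcc : Real.cos ψ ≤ Real.cos δ := Real.cos_le_cos_of_nonneg_of_le_pi p1.le (by linarith) hδψ
  obtain ⟨c, hc⟩ : ∃ c, c = Real.cos ψ / Real.cos δ := ⟨_, rfl⟩
  have hc0 : 0 < c := hc ▸ div_pos cψ cδ
  have hc1 : c ≤ 1 := by rw [hc, div_le_one cδ]; exact hcc
  have hψ : Real.cos ψ = Real.cos δ * c := by rw [hc]; field_simp
  obtain ⟨φ, hφ⟩ : ∃ φ, Real.cos φ = c := ⟨Real.arccos c, Real.cos_arccos (by linarith) hc1⟩
  obtain ⟨x, y, hx, hy, hxy⟩ := exists_orthonormal_pair hE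
  have hnorm : ∀ t : ℝ, ‖Real.cos t • x + Real.sin t • y‖ = 1 := by
    intro t
    rw [← pow_left_inj₀ (norm_nonneg _) zero_le_one two_ne_zero, norm_add_sq_real, norm_smul,
      norm_smul, hx, hy, real_inner_smul_left, real_inner_smul_right, hxy]
    simp
  have h1 : massRatio m 1 = massWeight m 1 ^ 2 := by simp [massWeight_sq hm, word32]
  refine ⟨fun k => Real.cos (k * φ) • x + Real.sin (k * φ) • y,
    fun k => massWeight m k * Real.sin ((N - k) * ψ), fun k _ => hnorm _, fun k hk => ?_, by simp,
    fun k hk => ?_, ?_⟩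
  · have hk' : (k : ℝ) < N := by exact_mod_cast hk
    refine mul_pos (massWeight_pos hm k) (Real.sin_pos_of_pos_of_lt_pi
      (mul_pos (sub_pos.2 hk') hψ0) ?_)
    have : (0 : ℝ) ≤ k * ψ := by positivity
    linarith
  · have e1 : (Real.cos (k * φ) • x + Real.sin (k * φ) • y) +
        (Real.cos ((k + 2 : ℕ) * φ) • x + Real.sin ((k + 2 : ℕ) * φ) • y) =
        (2 * c) • (Real.cos ((k + 1 : ℕ) * φ) • x + Real.sin ((k + 1 : ℕ) * φ) • y) := by
      push_cast
      rw [show ((k : ℝ) + 2) * φ = (k + 1) * φ + φ by ring,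
        show (k : ℝ) * φ = (k + 1) * φ - φ by ring, Real.sin_add, Real.sin_sub, Real.cos_add,
        Real.cos_sub, hφ]
      module
    simp only [e1]
    rw [smul_smul]
    congr 1
    push_cast
    rw [massWeight_add_two, ← massWeight_sq hm,
      show ((N : ℝ) - k) * ψ = (N - (k + 1)) * ψ + ψ by ring,
      show ((N : ℝ) - (k + 2)) * ψ = (N - (k + 1)) * ψ - ψ by ring, Real.sin_add, Real.sin_sub, hψ,
      ← hw k]
    ring
  · have hin : inner ℝ (Real.cos ((0 : ℕ) * φ) • x + Real.sin ((0 : ℕ) * φ) • y)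
        (Real.cos ((1 : ℕ) * φ) • x + Real.sin ((1 : ℕ) * φ) • y) = c := by
      simp [inner_add_right, real_inner_smul_right, hxy, hx, hφ]
    have sN := Real.sin_pos_of_pos_of_lt_pi (x := N * ψ) (by positivity) hNψ
    have w0 := massWeight_pos hm 0
    refine (norm_first_iff (hnorm _) (hnorm _) (massRatio_lt_one hm 1).le ?_).2 ?_
    · simp only [Nat.cast_zero, sub_zero]
      positivity
    · rw [hin, h1]
      simp only [Nat.cast_zero, sub_zero, Nat.cast_one]
      have hS := sin_pred_mul_identity N ψ
      rw [hψ, ← hw 0] at hS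
      simp only [zero_add] at hS
      refine mul_left_cancel₀ (pow_ne_zero 2 sγ.ne') ?_
      linear_combination Real.sin γ ^ 2 * massWeight m 1 ^ 2 * hS + Real.sin (N * ψ) ^ 2 * hid +
        massWeight m 1 ^ 2 * (Real.sin ψ * Real.sin γ + Real.sin δ * Real.sin (N * ψ)) * hsin

/-- The time between collisions `k` and `k + 1` is `1 / (ρ k ρ (k + 1))`, the distance of particles 2
and 3 at collision `k` is `1 / ρ k`. -/
lemma IsCollisionChain.exists_capture {m : Fin 3 → ℝ} {N : ℕ} {e : ℕ → E} {ρ : ℕ → ℝ}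
    (hm : ∀ i, 0 < m i) (hN : 2 ≤ N) (hNe : Even N) (h : IsCollisionChain m N e ρ) :
    ∃ P : CollisionSequence E m N word32, P.IsCapture := by
  have hr := massRatio_lt_one hm 1
  have hρ0 := h.pos 0 (by omega)
  have hM : 0 < ∑ j, m j := Finset.sum_pos (fun i _ => hm i) Finset.univ_nonempty
  have hw0 : word32 0 = 2 := by simp [word32]
  have hw1 : word32 1 = 1 := by simp [word32]
  -- `v` is the incident velocity, `V` that of the centre of mass, `T` the time, and `X`, `Y` are the
  -- positions and velocities relative to particle 1
  obtain ⟨v, hv⟩ : ∃ v, v = (1 - massRatio m 1)⁻¹ • ((massRatio m 1 * ρ 0) • e 1 - ρ 1 • e 0) :=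
    ⟨_, rfl⟩
  have hv' : (1 - massRatio m 1) • v = (massRatio m 1 * ρ 0) • e 1 - ρ 1 • e 0 := by
    rw [hv, smul_smul, mul_inv_cancel₀ (sub_pos.2 hr).ne', one_smul]
  have hvn : ‖v‖ = ρ 0 := by
    have := congrArg norm hv'
    rw [norm_smul, norm_sub_rev ((massRatio m 1 * ρ 0) • e 1), h.first, Real.norm_of_nonneg (sub_pos.2 hr).le] at this
    exact mul_left_cancel₀ (sub_pos.2 hr).ne' this
  obtain ⟨V, hV⟩ : ∃ V, V = (∑ j, m j)⁻¹ • m 0 • v := ⟨_, rfl⟩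
  obtain ⟨T, hT⟩ : ∃ T : ℕ → ℝ, ∀ k, T (k + 1) = T k + (ρ k * ρ (k + 1))⁻¹ :=
    ⟨fun k => ∑ i ∈ Finset.range k, (ρ i * ρ (i + 1))⁻¹, fun k => Finset.sum_range_succ _ _⟩
  obtain ⟨X, hX⟩ : ∃ X : ℕ → Fin 3 → E, ∀ k i, X k i =
      if i = word32 k then ((-1 : ℝ) ^ k * (ρ k)⁻¹) • e k else 0 := ⟨_, fun _ _ => rfl⟩
  obtain ⟨Y, hY0, hY⟩ : ∃ Y : ℕ → Fin 3 → E, (∀ i, Y 0 i = if i = 0 then 0 else v) ∧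
      ∀ k i, Y (k + 1) i = if i = word32 (k + 1) then ((-1 : ℝ) ^ (k + 1) * ρ k) • e (k + 1)
        else if i = word32 k then ((-1 : ℝ) ^ (k + 1) * ρ (k + 1)) • e k else 0 :=
    ⟨fun k => Nat.casesOn k (fun i => if i = 0 then 0 else v) (fun k i =>
      if i = word32 (k + 1) then ((-1 : ℝ) ^ (k + 1) * ρ k) • e (k + 1)
        else if i = word32 k then ((-1 : ℝ) ^ (k + 1) * ρ (k + 1)) • e k else 0),
      fun _ => rfl, fun _ _ => rfl⟩
  have hYz : ∀ k, Y k 0 = 0 := by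
    intro k
    cases k with
    | zero => simp [hY0]
    | succ k => simp [hY, (word32_ne_zero _).symm]
  have hYa : ∀ k, Y (k + 1) (word32 (k + 1)) = ((-1 : ℝ) ^ (k + 1) * ρ k) • e (k + 1) := by
    intro k
    rw [hY, if_pos rfl]
  have hYb : ∀ k, Y (k + 1) (word32 k) = ((-1 : ℝ) ^ (k + 1) * ρ (k + 1)) • e k := by
    intro k
    rw [hY, if_neg (word32_succ_ne k).symm, if_pos rfl]
  have hvel : ∀ i, i ≠ 0 → ofRelative m V (Y 0) i = 0 := by
    intro i hi
    have e1 : ∑ j, m j • Y 0 j = (m 1 + m 2) • v := by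
      rw [Fin.sum_univ_three, hY0, hY0, hY0, add_smul]
      simp
    rw [ofRelative, e1, hY0, if_neg hi, hV, ← smul_add, ← add_smul, ← add_assoc,
      ← Fin.sum_univ_three, smul_smul, inv_mul_cancel₀ hM.ne', one_smul, sub_self]
  refine ⟨{ time := T, pos := fun k => ofRelative m (T k • V) (X k),
            vel := fun k => ofRelative m V (Y k), time_lt := ?_, free := ?_, contact := ?_,
            elastic := ?_ }, ⟨hvel 1 (by decide), hvel 2 (by decide), ?_, ?_, ?_⟩⟩
  · intro k hk
    rw [hT]
    have := inv_pos.2 (mul_pos (h.pos k (by omega)) (h.pos (k + 1) hk))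
    linarith
  · intro k hk i
    have p0 := (h.pos k (by omega)).ne'
    have p1 := (h.pos (k + 1) hk).ne'
    have hXX : X (k + 1) = X k + (T (k + 1) - T k) • Y (k + 1) := by
      funext i
      rw [hT, add_sub_cancel_left, Pi.add_apply, Pi.smul_apply, hX, hX, hY]
      by_cases h1 : i = word32 (k + 1)
      · rw [if_pos h1, if_pos h1, if_neg (h1 ▸ word32_succ_ne k), zero_add, smul_smul]
        congr 1
        field_simp
      · rw [if_neg h1, if_neg h1]
        by_cases h2 : i = word32 k
        · rw [if_pos h2, if_pos h2, smul_smul, ← add_smul, pow_succ]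
          rw [show (-1 : ℝ) ^ k * (ρ k)⁻¹ + (ρ k * ρ (k + 1))⁻¹ * ((-1) ^ k * -1 * ρ (k + 1)) = 0 by
            field_simp; ring, zero_smul]
        · rw [if_neg h2, if_neg h2]; simp
    have hTV : T (k + 1) • V = T k • V + (T (k + 1) - T k) • V := by module
    rw [hXX, hTV, ofRelative_add_smul]
  · intro k hk i j hi hj
    rw [← sub_eq_zero, ofRelative_sub, hX, hX, if_neg hi, if_neg hj, sub_zero]
  · intro k hk
    refine isElasticCollision_ofRelative hm (word32_ne_zero k) (word32_ne_zero (k + 1))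
      (word32_succ_ne k) V (hYz _) (hYz _) ?_ ?_
    · cases k with
      | zero =>
        rw [hYa, hYb, zero_add, hw0, hw1, hY0, hY0, if_neg (by decide), if_neg (by decide)]
        linear_combination (norm := module) -hv'
      | succ k =>
        rw [hYb, hYa, hYa, word32_add_two, hYb]
        have := congrArg (fun x => (-1 : ℝ) ^ (k + 1) • x) (h.reflect k (by omega))
        rw [pow_succ _ (k + 1)]
        linear_combination (norm := module) -this
    · cases k with
      | zero =>
        rw [hYa, zero_add, hw1, hY0, if_neg (by decide), hvn, norm_smul,
          h.norm_eq_one 1 (by omega), pow_one, neg_one_mul, norm_neg, mul_one,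
          Real.norm_of_nonneg hρ0.le]
      | succ k =>
        rw [hYa, word32_add_two, hYb, norm_smul, norm_smul, h.norm_eq_one k (by omega),
          h.norm_eq_one (k + 1 + 1) (by omega)]
        simp
  · change ofRelative m V (Y 0) 0 ≠ 0
    have h1 := ofRelative_sub m V (Y 0) 0 1
    rw [hvel 1 (by decide), hY0, hY0, if_pos rfl, if_neg (by decide), sub_zero, sub_zero] at h1
    rw [h1, ← norm_pos_iff, hvn]
    exact hρ0
  · rw [← sub_ne_zero]
    change ofRelative m (T 0 • V) (X 0) 1 - ofRelative m (T 0 • V) (X 0) 2 ≠ 0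
    rw [ofRelative_sub, hX, hX, hw0, if_pos rfl, if_neg (by decide), sub_zero]
    have := norm_pos_iff.1 (by rw [h.norm_eq_one 0 (by omega)]; exact one_pos)
    exact smul_ne_zero (by simpa using hρ0.ne') this
  · rw [← sub_eq_zero]
    change ofRelative m V (Y N) 0 - ofRelative m V (Y N) 1 = 0
    obtain ⟨k, rfl⟩ : ∃ k, N = k + 1 := ⟨N - 1, by omega⟩
    have hwk : word32 k = 1 := by
      rw [Nat.even_add_one] at hNe
      simp [word32, hNe]
    have h1 := hYb k
    rw [hwk, h.last, mul_zero, zero_smul] at h1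
    rw [ofRelative_sub, h1, hYz, sub_zero]

/-! ### Admissible angles -/

lemma cos_sin_of_pi_sub_two_mul (n : ℕ) (ψ : ℝ) :
    Real.cos ((Real.pi - 2 * ψ) / 2) = Real.sin ψ ∧
      Real.sin (n * (Real.pi - 2 * ψ)) ^ 2 = Real.sin (2 * n * ψ) ^ 2 := by
  constructor
  · rw [← Real.cos_pi_div_two_sub]; congr 1; ring
  · rw [show n * (Real.pi - 2 * ψ) = n * Real.pi - 2 * n * ψ by ring, Real.sin_nat_mul_pi_sub,
      neg_sq, mul_pow, ← pow_mul, mul_comm n 2, pow_mul]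
    simp

/-- The interval for `θ` allows `ψ < π / (2 n - 1)`, slightly more than `ψ < π / (2 n)`. In the
additional part `sin² ψ / sin² (2 n ψ) > 1`, whereas in the region `a ≤ 1` if `n ≥ 2`, so that the
right-hand side `sin² δ / sin² γ` of the equation is at most 1. -/
lemma isAdmissibleAngle_iff {n : ℕ} (hn : 1 ≤ n) {a b : ℝ} (ha : 0 < a) (hb : 0 < b)
    (hR : (a, b) ∈ captureRegion n) (ψ : ℝ) :
    IsAdmissibleAngle n a b (Real.pi - 2 * ψ) ↔ 0 < ψ ∧ 2 * n * ψ < Real.pi ∧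
      Real.sin ψ * Real.sin (angleTwo a b) = Real.sin (angleOne a b) * Real.sin (2 * n * ψ) := by
  obtain ⟨-, hR2⟩ := (mem_captureRegion_iff hn ha hb).1 hR
  have hs := angle_sum ha hb
  have hK := sin_angleOne_sq ha hb
  obtain ⟨-, -, p1, q1⟩ := angleOne_spec ha hb
  obtain ⟨-, -, p2, q2⟩ := angleTwo_spec ha hb
  obtain ⟨-, -, p3, q3⟩ := angleThree_spec ha hb
  have s1 := Real.sin_pos_of_pos_of_lt_pi p1 (by linarith)
  have s2 := Real.sin_pos_of_pos_of_lt_pi p2 (by linarith)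
  have hn' : (1 : ℝ) ≤ n := by exact_mod_cast hn
  obtain ⟨ac, as⟩ := cos_sin_of_pi_sub_two_mul n ψ
  have hpi := Real.pi_pos
  unfold IsAdmissibleAngle
  rw [ac, as, mem_Ioo, div_lt_iff₀ (by linarith)]
  constructor
  · rintro ⟨h1, ⟨h2, h3⟩, h4, h5⟩
    have h4' : Real.sin (2 * n * ψ) ≠ 0 := by
      rw [← pow_ne_zero_iff two_ne_zero, ← as]; exact pow_ne_zero 2 h4
    have hψ0 : 0 < ψ := by linarith
    have sψ := Real.sin_pos_of_pos_of_lt_pi hψ0 (by linarith)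
    rw [div_eq_iff (pow_ne_zero 2 h4')] at h5
    have key : (Real.sin ψ * Real.sin (angleTwo a b)) ^ 2 =
        (Real.sin (angleOne a b) * Real.sin (2 * n * ψ)) ^ 2 := by
      rw [mul_pow, mul_pow, h5, hK]; ring
    have hlt : 2 * n * ψ < Real.pi := by
      by_contra! hge
      rcases hge.eq_or_lt with heq | hgt
      · rw [← heq] at h4'; simp at h4'
      · have hn2 : (2 : ℝ) ≤ n := by
          have : 2 ≤ n := by
            by_contra! hlt
            obtain rfl : n = 1 := by omega
            push_cast at hgt
            linarith
          exact_mod_cast this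
        -- `0 < 2 n ψ - π < ψ`
        have hsmall : Real.sin (2 * n * ψ - Real.pi) < Real.sin ψ :=
          Real.sin_lt_sin_of_lt_of_le_pi_div_two (by linarith) (by linarith) (by linarith)
        have hpos : 0 < Real.sin (2 * n * ψ - Real.pi) :=
          Real.sin_pos_of_pos_of_lt_pi (by linarith) (by linarith)
        have h12 : Real.sin (angleOne a b) ≤ Real.sin (angleTwo a b) :=
          Real.sin_le_sin_of_le_of_le_pi_div_two (by linarith) q2.le (by nlinarith)
        rw [Real.sin_sub_pi] at hsmall hpos
        have : Real.sin (angleOne a b) * -Real.sin (2 * n * ψ) <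
            Real.sin ψ * Real.sin (angleTwo a b) := by
          nlinarith
        have h' := pow_lt_pow_left₀ this (by positivity) two_ne_zero
        rw [key, mul_neg, neg_sq] at h'
        exact lt_irrefl _ h'
    refine ⟨hψ0, hlt, ?_⟩
    have sN := Real.sin_pos_of_pos_of_lt_pi (x := 2 * n * ψ) (by positivity) hlt
    exact (pow_left_inj₀ (by positivity) (by positivity) two_ne_zero).1 key
  · rintro ⟨h1, h2, h3⟩
    have sN := Real.sin_pos_of_pos_of_lt_pi (x := 2 * n * ψ) (by positivity) h2
    refine ⟨by nlinarith, ⟨by nlinarith, by linarith⟩, ?_, ?_⟩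
    · rw [← pow_ne_zero_iff two_ne_zero, as]; positivity
    · rw [div_eq_iff (by positivity)]
      refine mul_right_cancel₀ (pow_ne_zero 2 s2.ne') ?_
      rw [← mul_pow, h3, mul_pow, hK]
      ring

end

theorem mainTheorem1 {E : Type*} [NormedAddCommGroup E] [InnerProductSpace ℝ E]
    (hE : 1 < Module.rank ℝ E) (m : Fin 3 → ℝ) (hm : ∀ i, 0 < m i) (n : ℕ) (hn : 1 ≤ n)
    (a b : ℝ) (ha : a = m 0 / m 1) (hb : b = m 2 / m 1) :
    -- each horizontal line `b = b₀ > 0` meets each curve once, `C_{2n}` left of `C_{2n-1}`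
    (∀ b₀ : ℝ, 0 < b₀ → ∃ aL aR : ℝ, 0 < aL ∧ aL < aR ∧
      (∀ a₀ : ℝ, (a₀, b₀) ∈ curveEven n ↔ a₀ = aL) ∧
      (∀ a₀ : ℝ, (a₀, b₀) ∈ curveOdd n ↔ a₀ = aR)) ∧
    -- the process is allowed exactly between the curves
    (Nonempty (Process32 E m n) ↔ (a, b) ∈ captureRegion n) ∧
    -- with a first collision that is not trivial, exactly when moreover `(a, b) ∉ C_{2n-1}`
    ((∃ P : Process32 E m n, P.1.IsGenuine) ↔ (a, b) ∈ captureRegion n ∧ (a, b) ∉ curveOdd n) ∧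
    -- the admissible angle, tied to the common scattering angle of the collisions after the first
    ((a, b) ∈ captureRegion n → ∃ θ : ℝ, IsAdmissibleAngle n a b θ ∧
      (∀ θ' : ℝ, IsAdmissibleAngle n a b θ' → θ' = θ) ∧
      ∀ (P : Process32 E m n) (k : ℕ), 1 ≤ k → k < 2 * n →
        Real.cos θ =
          1 - 2 * b * Real.sin (P.1.scatteringAngle k / 2) ^ 2 / ((a + 1) * (a + b))) := by
  have ha0 : 0 < a := ha ▸ div_pos (hm 0) (hm 1)
  have hb0 : 0 < b := hb ▸ div_pos (hm 2) (hm 1)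
  have hN : 2 ≤ 2 * n := by omega
  have hNe : Even (2 * n) := even_two_mul n
  have hN2 : ((2 * n : ℕ) : ℝ) = 2 * n := by push_cast; rfl
  obtain ⟨c1, -, p1, q1⟩ := angleOne_spec ha0 hb0
  obtain ⟨-, -, p2, q2⟩ := angleTwo_spec ha0 hb0
  have s1 := Real.sin_pos_of_pos_of_lt_pi p1 (by linarith)
  have hreg := (exists_angle_iff hN p1 q1 p2 q2).trans
    (hN2 ▸ (mem_captureRegion_iff hn ha0 hb0).symm)
  have hchain : ∀ P : Process32 E m n, IsCollisionChain m (2 * n) P.1.direction P.1.speed :=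
    fun P => CollisionSequence.isCollisionChain hm hN hNe P.2
  have hex : Nonempty (Process32 E m n) ↔ (a, b) ∈ captureRegion n := by
    rw [← hreg]
    constructor
    · rintro ⟨P⟩
      obtain ⟨ψ, h1, h2, h3, h4, -⟩ := (hchain P).exists_angle hm hN
      rw [← ha, ← hb] at h3 h4
      exact ⟨ψ, h1, h2, h3, h4⟩
    · rintro ⟨ψ, h1, h2, h3, h4⟩
      rw [ha, hb] at h3 h4
      obtain ⟨e, ρ, h⟩ := exists_chain hE hm hN h1 h2 h3 h4
      obtain ⟨P, hP⟩ := h.exists_capture hm hN hNe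
      exact ⟨⟨P, hP⟩⟩
  have hgen : ∀ P : Process32 E m n, P.1.IsGenuine ↔ (a, b) ∉ curveOdd n := by
    intro P
    have h1 := CollisionSequence.vel_one_eq_iff hm hN hNe P.2
    rw [(hchain P).trivial_iff hm hN, ← ha, ← hb, hN2] at h1
    have h2 := mem_curveOdd_iff hn (a := a) (b := b)
    simp only [ha0, hb0, true_and] at h2
    rw [h2, ← h1]
    refine ⟨fun h => h 0 (by omega), fun h k hk => ?_⟩
    cases k with
    | zero => exact h
    | succ k => exact CollisionSequence.vel_succ_ne hm hN hNe P.2 hk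
  refine ⟨fun b₀ hb₀ => ?_, hex, ?_, fun hR => ?_⟩
  · obtain ⟨aL, aR, h1, h2, h3, h4, -⟩ := curve_line hn hb₀
    exact ⟨aL, aR, h1, h2, h3, h4⟩
  · rw [← hex]
    exact ⟨fun ⟨P, hP⟩ => ⟨⟨P⟩, (hgen P).1 hP⟩, fun ⟨⟨P⟩, h⟩ => ⟨P, (hgen P).2 h⟩⟩
  · obtain ⟨ψ, h1, h2, h3, h4⟩ := hreg.2 hR
    rw [hN2] at h2
    have huniq : ∀ ψ' : ℝ, 0 < ψ' → 2 * n * ψ' < Real.pi → Real.sin ψ' * Real.sin (angleTwo a b) =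
        Real.sin (angleOne a b) * Real.sin (2 * n * ψ') → ψ' = ψ := by
      intro ψ' h1' h2' h4'
      rw [← hN2] at h2' h4' h2
      exact eq_of_sin_mul_eq hN h1' h1 h2' h2 s1.ne' h4' h4
    refine ⟨Real.pi - 2 * ψ, (isAdmissibleAngle_iff hn ha0 hb0 hR ψ).2 ⟨h1, h2, hN2 ▸ h4⟩,
      fun θ' hθ' => ?_, fun P k hk1 hk => ?_⟩
    · obtain ⟨ψ', rfl⟩ : ∃ ψ', θ' = Real.pi - 2 * ψ' := ⟨(Real.pi - θ') / 2, by ring⟩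
      obtain ⟨h1', h2', h4'⟩ := (isAdmissibleAngle_iff hn ha0 hb0 hR ψ').1 hθ'
      rw [huniq ψ' h1' h2' h4']
    · obtain ⟨k, rfl⟩ : ∃ l, k = l + 1 := ⟨k - 1, by omega⟩
      obtain ⟨ψ', h1', h2', -, h4', h5', -⟩ := (hchain P).exists_angle hm hN
      rw [← ha, ← hb] at h4' h5'
      rw [hN2] at h2' h4'
      obtain rfl := huniq ψ' h1' h2' h4'
      have hi := ((hchain P).step hm (k := k) (by omega)).2.2
      rw [(hchain P).inner_eq hm (by omega)] at hi
      have hβ : Real.sin (P.1.scatteringAngle (k + 1) / 2) ^ 2 =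
          inner ℝ (P.1.direction 0) (P.1.direction 1) ^ 2 := by
        rw [Real.sin_sq_eq_half_sub, mul_div_cancel₀ _ two_ne_zero,
          CollisionSequence.scatteringAngle_succ hm hN hNe P.2 hk, InnerProductGeometry.cos_angle,
          inner_neg_right, norm_neg, (hchain P).norm_eq_one k (by omega),
          (hchain P).norm_eq_one (k + 2) (by omega)]
        linear_combination hi / 2
      rw [hβ, Real.cos_pi_sub, Real.cos_two_mul, h5', c1, mul_pow, div_pow, mul_pow,
        Real.sq_sqrt hb0.le, Real.sq_sqrt (by positivity), Real.sq_sqrt (by positivity)]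
      field_simp
      ring
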